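/- Let $B \neq \{0\}$ be a real separable Banach space and let $L = (L_t)_{t \ge 0}$ be a $B$-valued Lévy process on a probability space $(\Omega, \mathcal F, \mathbb P)$: $L_0 = 0$ a.s., the increments are independent, stationary and independent of the past, $L$ is stochastically continuous, and its paths are a.s. càdlàg. Suppose that $L$ is Gaussian with Lévy–Khintchine triplet $(b, Q, 0)$, where $b \in B$ and $Q : B^* \times B^* \to \mathbb R$ is a non-degenerate covariance (a non-degenerate, symmetric, positive semidefinite bilinear form), that is, $$\mathbb E\, e^{i\langle \varphi, L_t\rangle} = \exp\!\big(t\,(i\langle\varphi, b\rangle - \tfrac12 Q(\varphi,\varphi))\big), \qquad \varphi \in B^*,\ t \ge 0.$$ For $t > 0$ let $\mathcal F_t$ be the $\sigma$-algebra generated by $\{L_u : u \le t\}$ and the $\mathbb P$-null sets, and let $E^L(t) = L^2(\Omega, \mathcal F_t, \mathbb P)$ (complex-valued functions). Give $E^L = \{(t,f) : t > 0,\ f \in E^L(t)\}$ the Borel structure induced by $(0,\infty) \times L^2(\Omega, \mathcal F, \mathbb P)$, and define the product of $f \in E^L(s)$ and $g \in E^L(t)$ by $fg := f \cdot S_{s,t}\,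 g \in E^L(s+t)$, where the shift $S_{s,t}$ sends a functional $G\big((L_u)_{0 \le u \le t}\big)$ to $G\big((L_{s+u} - L_s)_{0 \le u \le t}\big)$. Then $E^L$ is a product system of Hilbert spaces: as a measurable family of Hilbert spaces it is isomorphic to the trivial bundle $(0,\infty)\times \ell^2(\mathbb N)$, and the multiplication is measurable, associative, and induces unitaries $E^L(s) \otimes E^L(t) \to E^L(s+t)$ for all $s,t>0$. Moreover $E^L$ is completely spatial (of type I): it has a unit, and for every $t > 0$ the space $E^L(t)$ is the closed linear span of the finite products $u_1(t_1) u_2(t_2) \cdots u_k(t_k)$, where $k \ge 1$, $t_1, \dots, t_k > 0$, $t_1 + \cdots + t_k = t$ and $u_1, \dots, u_k$ are units of $E^L$. Here a unit is a non-zero Borel section $t \mapsto u(t) \in E^L(t)$, $t > 0$, with $u(s+t) = u(s)u(t)$ for all $s, t > 0$. -/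

import Mathlib

open MeasureTheory ProbabilityTheory Filter Topology
open scoped NNReal ENNReal InnerProductSpace

universe u

namespace ProductSystems

/-! ### Product systems of Hilbert spaces -/

/-- The parameter semigroup `(0, ∞)`. -/
abbrev PosTime : Type := {t : ℝ≥0 // 0 < t}

/-- The data of a product system: a family of complex inner product spaces `E(t)`, `t > 0`,
a Borel structure on the total space `{(t, x) | x ∈ E(t)}` and a multiplication
`E(s) × E(t) → E(s + t)`. The laws are in `IsProductSystem`. -/
structure HilbertBundle where
  /-- the fibre `E(t)` -/
  Fiber : PosTime → Type u
  [normed : ∀ t, NormedAddCommGroup (Fiber t)]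
  [inner : ∀ t, InnerProductSpace ℂ (Fiber t)]
  /-- the Borel structure of the total space -/
  borelStructure : MeasurableSpace (Σ t, Fiber t)
  /-- the multiplication -/
  mul : ∀ {s t : PosTime}, Fiber s → Fiber t → Fiber (s + t)

attribute [instance] HilbertBundle.normed HilbertBundle.inner

namespace HilbertBundle

variable (E : HilbertBundle.{u})

/-- The total space `{(t, x) | t > 0, x ∈ E(t)}`. -/
abbrev Total : Type u := Σ t, E.Fiber t

instance : MeasurableSpace (Σ t, E.Fiber t) := E.borelStructure

/-- The Hilbert space `ℓ²(ℕ)`. -/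
abbrev EllTwo : Type := lp (fun _ : ℕ => ℂ) 2

/-- The product Borel structure of the trivial bundle `(0, ∞) × ℓ²(ℕ)`. -/
@[reducible] noncomputable def trivialBorel : MeasurableSpace (PosTime × EllTwo) :=
  MeasurableSpace.prod inferInstance (borel EllTwo)

/-- The bundle is isomorphic, as a measurable family of Hilbert spaces, to the trivial bundle
`(0, ∞) × ℓ²(ℕ)`: there are unitaries `V_t : E(t) → ℓ²(ℕ)` such that `(t, x) ↦ (t, V_t x)` is a
Borel isomorphism. -/
def IsTrivializable : Prop :=
  ∃ V : ∀ t, E.Fiber t ≃ₗᵢ[ℂ] EllTwo,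
    Measurable[E.borelStructure, trivialBorel] (fun p : Σ t, E.Fiber t => (p.1, V p.1 p.2)) ∧
    Measurable[trivialBorel, E.borelStructure]
      (fun q : PosTime × EllTwo => (⟨q.1, (V q.1).symm q.2⟩ : Σ t, E.Fiber t))

/-- `E` is a product system. The trivialization makes every fibre a separable infinite-dimensional
Hilbert space and the total space a standard Borel space whose Borel structure is compatible with
the projection, the vector space operations and the inner products. The multiplication is
measurable and associative, and it extends to unitaries `E(s) ⊗ E(t) → E(s + t)`: it is bilinear,
it multiplies inner products, and products span a dense subspace. -/
structure IsProductSystem : Prop where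
  trivializable : E.IsTrivializable
  measurable_mul : Measurable
    (fun p : E.Total × E.Total => (⟨p.1.1 + p.2.1, E.mul p.1.2 p.2.2⟩ : E.Total))
  add_mul : ∀ {s t : PosTime} (x x' : E.Fiber s) (y : E.Fiber t),
    E.mul (x + x') y = E.mul x y + E.mul x' y
  mul_add : ∀ {s t : PosTime} (x : E.Fiber s) (y y' : E.Fiber t),
    E.mul x (y + y') = E.mul x y + E.mul x y'
  smul_mul : ∀ {s t : PosTime} (c : ℂ) (x : E.Fiber s) (y : E.Fiber t),
    E.mul (c • x) y = c • E.mul x y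
  mul_smul : ∀ {s t : PosTime} (c : ℂ) (x : E.Fiber s) (y : E.Fiber t),
    E.mul x (c • y) = c • E.mul x y
  inner_mul : ∀ {s t : PosTime} (x x' : E.Fiber s) (y y' : E.Fiber t),
    ⟪E.mul x y, E.mul x' y'⟫_ℂ = ⟪x, x'⟫_ℂ * ⟪y, y'⟫_ℂ
  dense_mul : ∀ s t : PosTime, (Submodule.span ℂ
    (Set.range fun p : E.Fiber s × E.Fiber t => E.mul p.1 p.2)).topologicalClosure = ⊤
  mul_assoc : ∀ {r s t : PosTime} (x : E.Fiber r) (y : E.Fiber s) (z : E.Fiber t),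
    (⟨r + (s + t), E.mul x (E.mul y z)⟩ : E.Total) = ⟨r + s + t, E.mul (E.mul x y) z⟩

/-- A unit: a non-zero Borel section `u` with `u(s + t) = u(s) u(t)`. -/
structure IsUnitSection (v : ∀ t, E.Fiber t) : Prop where
  measurable : Measurable (fun t => (⟨t, v t⟩ : E.Total))
  ne_zero : ∃ t, v t ≠ 0
  map_add : ∀ s t, v (s + t) = E.mul (v s) (v t)

/-- `E.UnitProduct t x`: `x ∈ E(t)` is a finite product `u₁(t₁) u₂(t₂) ⋯ u_k(t_k)` of values of
units, with `k ≥ 1` and `t₁ + ⋯ + t_k = t`. -/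
inductive UnitProduct : ∀ t : PosTime, E.Fiber t → Prop
  | single (v : ∀ t, E.Fiber t) (hv : E.IsUnitSection v) (t : PosTime) : UnitProduct t (v t)
  | cons (v : ∀ t, E.Fiber t) (hv : E.IsUnitSection v) (s t : PosTime) (x : E.Fiber t)
      (hx : UnitProduct t x) : UnitProduct (s + t) (E.mul (v s) x)

/-- `E` has a unit. -/
def IsSpatial : Prop := ∃ v, E.IsUnitSection v

/-- `E` is completely spatial (of type I): it is spatial and every fibre is the closed linear span
of the finite products of values of units. -/
def IsCompletelySpatial : Prop :=
  E.IsSpatial ∧ ∀ t, (Submodule.span ℂ {x | E.UnitProduct t x}).topologicalClosure = ⊤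

end HilbertBundle

/-- The path of increments after time `s`, up to time `s + t`:
`u ↦ L_{s+u} - L_s`, `0 ≤ u ≤ t`. -/
def incrPath {Ω B : Type*} [Sub B] (L : ℝ≥0 → Ω → B) (s t : ℝ≥0) (ω : Ω) :
    Set.Iic t → B :=
  fun v => L (s + v) ω - L s ω

/-! ### Lévy processes in a separable Banach space -/

section Levy

variable {Ω : Type u} {B : Type*} [MeasurableSpace Ω] [NormedAddCommGroup B]
  [MeasurableSpace B]

/-- The σ-algebra `σ(L_u : u ≤ t)`. -/
@[reducible] def past (L : ℝ≥0 → Ω → B) (t : ℝ≥0) : MeasurableSpace Ω :=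
  ⨆ u : Set.Iic t, MeasurableSpace.comap (L u) inferInstance

/-- A `B`-valued Lévy process `L = (L_t)_{t ≥ 0}` on the probability space `(Ω, P)`. -/
structure IsLevyProcess (L : ℝ≥0 → Ω → B) (P : Measure Ω) : Prop where
  measurable : ∀ t, Measurable (L t)
  /-- stationary increments, independent of the past -/
  indep_past : ∀ t s, Indep (past L t)
    (MeasurableSpace.comap (fun ω => L (t + s) ω - L t ω) inferInstance) P
  stationary : ∀ t s, IdentDistrib (fun ω => L (t + s) ω - L t ω) (L s) P P
  /-- independent increments -/
  indep_increments : HasIndepIncrements L P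
  /-- stochastic continuity -/
  stochasticContinuity : ∀ ε : ℝ, 0 < ε → ∀ s : ℝ≥0,
    Tendsto (fun t : ℝ≥0 => P {ω | ε < ‖L (s + t) ω - L s ω‖}) (𝓝[>] 0) (𝓝 0)
  /-- càdlàg paths -/
  cadlag : ∀ᵐ ω ∂P, ∀ t : ℝ≥0, ContinuousWithinAt (fun r => L r ω) (Set.Ici t) t ∧
    ∃ l : B, Tendsto (fun r => L r ω) (𝓝[<] t) (𝓝 l)
  /-- initial condition -/
  zero : ∀ᵐ ω ∂P, L 0 ω = 0

section Triplet

variable [NormedSpace ℝ B]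

open Classical in
/-- The Lévy exponent with drift `b`, covariance `Q` and Lévy measure `ν`. -/
noncomputable def levyExponent (b : B) (Q : LinearMap.BilinForm ℝ (StrongDual ℝ B))
    (ν : Measure B) (φ : StrongDual ℝ B) : ℂ :=
  Complex.I * (φ b : ℂ) - (1 / 2 : ℂ) * (Q φ φ : ℂ) +
    ∫ x in {0}ᶜ, (Complex.exp (Complex.I * (φ x : ℂ)) - 1 -
      Complex.I * (φ x : ℂ) * (if ‖x‖ ≤ 1 then 1 else 0)) ∂ν

/-- `(b, Q, ν)` is the Lévy–Khintchine triplet of `L`: `Q` is symmetric and positive semidefinite,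
`ν` is a Lévy measure, and the characteristic function of `L_t` is `exp (t Ψ)`, where `Ψ` is the
Lévy exponent of `(b, Q, ν)`. -/
structure HasTriplet (L : ℝ≥0 → Ω → B) (P : Measure Ω) (b : B)
    (Q : LinearMap.BilinForm ℝ (StrongDual ℝ B)) (ν : Measure B) : Prop where
  symm : ∀ φ ψ, Q φ ψ = Q ψ φ
  nonneg : ∀ φ, 0 ≤ Q φ φ
  levyMeasure_zero : ν {0} = 0
  levyMeasure_lt_top : ∫⁻ x, ENNReal.ofReal (min 1 (‖x‖ ^ 2)) ∂ν < ∞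
  charFun_eq : ∀ (t : ℝ≥0) (φ : StrongDual ℝ B),
    ∫ ω, Complex.exp (Complex.I * (φ (L t ω) : ℂ)) ∂P
      = Complex.exp (((t : ℝ) : ℂ) * levyExponent b Q ν φ)

end Triplet

/-! ### The product system of a Lévy process -/

/-- The Hilbert space `E(t) = L²(Ω, 𝓕_t, P)`, where `𝓕_t` is generated by `σ(L_u : u ≤ t)` and the
null sets: the square integrable (classes of) functions on `Ω` that coincide almost everywhere
with a `σ(L_u : u ≤ t)`-measurable function. -/
noncomputable abbrev levyFiber (L : ℝ≥0 → Ω → B) (P : Measure Ω) (t : ℝ≥0) :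
    Submodule ℂ (Lp ℂ 2 P) :=
  lpMeas ℂ ℂ (past L t) 2 P

lemma past_eq_comap (L : ℝ≥0 → Ω → B) (t : ℝ≥0) :
    past L t = MeasurableSpace.comap (fun ω (v : Set.Iic t) => L v ω) MeasurableSpace.pi := by
  simp only [past, MeasurableSpace.pi, MeasurableSpace.comap_iSup, MeasurableSpace.comap_comp]
  rfl

lemma measurable_past {L : ℝ≥0 → Ω → B} {r t : ℝ≥0} (h : r ≤ t) :
    Measurable[past L t] (L r) := by
  rw [measurable_iff_comap_le]
  exact le_iSup (fun v : Set.Iic t => MeasurableSpace.comap (L v) inferInstance) ⟨r, h⟩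

lemma measurable_incrPath_aux {Ω' B' : Type*} [NormedAddCommGroup B'] [MeasurableSpace B']
    [SecondCountableTopology B'] [BorelSpace B'] {m : MeasurableSpace Ω'} {L' : ℝ≥0 → Ω' → B'}
    {s t : ℝ≥0} (h : ∀ r ≤ s + t, Measurable (L' r)) : Measurable (incrPath L' s t) := by
  refine measurable_pi_lambda _ fun v => ?_
  have h1 : s + (v : ℝ≥0) ≤ s + t := add_le_add_right v.2 s
  exact (h _ h1).sub (h s le_self_add)

/-- Every finite set of times lies on an increasing grid that starts at `0`. -/
lemma exists_grid (J : Finset ℝ≥0) :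
    ∃ (τ : ℕ → ℝ≥0) (n : ℕ), Monotone τ ∧ τ 0 = 0 ∧ ∀ r ∈ J, ∃ i ≤ n, τ i = r := by
  induction J using Finset.induction_on_max with
  | empty => exact ⟨fun _ => 0, 0, monotone_const, rfl, by simp⟩
  | insert a J ha ih =>
    obtain ⟨τ, n, hτ, h0, hJ⟩ := ih
    refine ⟨fun k => if k ≤ n then min (τ k) a else a, n + 1, ?_, by simp [h0], ?_⟩
    · intro i j hij
      dsimp only
      split_ifs with h1 h2
      · exact min_le_min_right _ (hτ hij)
      · exact min_le_right _ _
      · omega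
      · exact le_rfl
    · intro r hr
      rcases Finset.mem_insert.1 hr with rfl | hr
      · exact ⟨n + 1, le_rfl, by simp⟩
      · obtain ⟨i, hi, rfl⟩ := hJ r hr
        exact ⟨i, by omega, by simp [hi, (ha _ hr).le]⟩

variable [SecondCountableTopology B] [BorelSpace B]
  {L : ℝ≥0 → Ω → B} {P : Measure Ω}

lemma measurable_incrPath_past (s t : ℝ≥0) :
    Measurable[past L (s + t)] (incrPath L s t) :=
  measurable_incrPath_aux fun _ hr => measurable_past hr

namespace IsLevyProcess

lemma past_le (hL : IsLevyProcess L P) (t : ℝ≥0) : past L t ≤ ‹MeasurableSpace Ω› :=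
  iSup_le fun v => (hL.measurable v).comap_le

lemma measurable_incrPath (hL : IsLevyProcess L P) (s t : ℝ≥0) : Measurable (incrPath L s t) :=
  (measurable_incrPath_past s t).mono (hL.past_le _) le_rfl

variable [IsProbabilityMeasure P]

/-- The law of the path of increments does not depend on the initial time. -/
lemma identDistrib_incrPath (hL : IsLevyProcess L P) (s t : ℝ≥0) :
    IdentDistrib (incrPath L s t) (incrPath L 0 t) P P := by
  refine (identDistrib_iff_forall_finset_identDistrib
    (X := fun (v : Set.Iic t) ω => L (s + v) ω - L s ω)
    (Y := fun (v : Set.Iic t) ω => L (0 + v) ω - L 0 ω)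
    (hL.measurable_incrPath s t).aemeasurable (hL.measurable_incrPath 0 t).aemeasurable).2 ?_
  intro I
  obtain ⟨τ, n, hτ, h0, hI⟩ := exists_grid (I.image (fun v : Set.Iic t => (v : ℝ≥0)))
  have hI' : ∀ v : I, ∃ i, τ i = (v : Set.Iic t) := fun v => by
    obtain ⟨i, -, hi⟩ := hI _ (Finset.mem_image_of_mem _ v.2)
    exact ⟨i, hi⟩
  choose idx hidx using hI'
  have key : IdentDistrib (fun ω (k : ℕ) => L (s + τ (k + 1)) ω - L (s + τ k) ω)
      (fun ω (k : ℕ) => L (0 + τ (k + 1)) ω - L (0 + τ k) ω) P P := by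
    refine IdentDistrib.pi (fun k => ?_)
      (hL.indep_increments.nat (t := fun k => s + τ k) fun i j h => by dsimp only; gcongr; exact hτ h)
      (hL.indep_increments.nat (t := fun k => 0 + τ k) fun i j h => by dsimp only; gcongr; exact hτ h)
    obtain ⟨d, hd⟩ := exists_add_of_le (hτ k.le_succ)
    rw [Nat.succ_eq_add_one] at hd
    have h1 := hL.stationary (s + τ k) d
    have h2 := hL.stationary (0 + τ k) d
    rw [hd, ← add_assoc, ← add_assoc]
    exact h1.trans h2.symm
  have hΦ : Measurable (fun (y : ℕ → B) (v : I) => ∑ k ∈ Finset.range (idx v), y k) := by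
    fun_prop
  convert key.comp hΦ using 1
  · ext ω v
    simp [Finset.sum_range_sub (fun k => L (s + τ k) ω), hidx, h0]
  · ext ω v
    simp [Finset.sum_range_sub (fun k => L (τ k) ω), hidx, h0]

/-- The path of increments after time `s` is independent of the past before time `s`. -/
lemma indep_incrPath (hL : IsLevyProcess L P) (s t : ℝ≥0) :
    Indep (past L s) (MeasurableSpace.comap (incrPath L s t) MeasurableSpace.pi) P := by
  rw [past_eq_comap]
  refine (IndepFun_iff_Indep (fun ω (v : Set.Iic s) => L v ω) (incrPath L s t) P).1 ?_
  refine IndepFun.process_congr_left (X := fun (v : Set.Iic s) ω => L v ω - L 0 ω) ?_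
    (fun v => by filter_upwards [hL.zero] with ω hω; simp [hω])
  refine IndepFun.process_indepFun_process (Y := fun (v : Set.Iic t) ω => L (s + v) ω - L s ω)
    (fun v => (hL.measurable v).sub (hL.measurable 0))
    (fun v => (hL.measurable _).sub (hL.measurable s)) fun I J => ?_
  obtain ⟨τ, n, hτ, h0, hK⟩ := exists_grid
    (insert s ((I.image fun v : Set.Iic s => (v : ℝ≥0)) ∪
      J.image fun v : Set.Iic t => s + (v : ℝ≥0)))
  obtain ⟨m, hm, hms⟩ := hK s (by simp)
  have hI : ∀ v : I, ∃ i ≤ m, τ i = (v : Set.Iic s) := fun v => by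
    obtain ⟨i, -, hi⟩ := hK (v : Set.Iic s) (Finset.mem_insert_of_mem
      (Finset.mem_union_left _ (Finset.mem_image_of_mem _ v.2)))
    rcases le_total i m with h | h
    · exact ⟨i, h, hi⟩
    · refine ⟨m, le_rfl, le_antisymm (hi ▸ hτ h) ?_⟩
      rw [hms]; exact v.1.2
  have hJ : ∀ v : J, ∃ j ≤ n, m ≤ j ∧ τ j = s + (v : Set.Iic t) := fun v => by
    obtain ⟨j, hj, hj'⟩ := hK (s + (v : Set.Iic t)) (Finset.mem_insert_of_mem
      (Finset.mem_union_right _ (Finset.mem_image_of_mem _ v.2)))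
    rcases le_total m j with h | h
    · exact ⟨j, hj, h, hj'⟩
    · refine ⟨m, hm, le_rfl, le_antisymm ?_ (hj' ▸ hτ h)⟩
      rw [hms]; exact le_self_add
  choose i him hi using hI
  choose j hjn hmj hj using hJ
  have key := (hL.indep_increments.nat hτ).indepFun_finset (Finset.range m) (Finset.Ico m n)
    (by rw [Finset.disjoint_left]; intro a; simp; omega)
    (fun k => (hL.measurable _).sub (hL.measurable _))
  have hΦ : Measurable (fun (y : Finset.range m → B) (v : I) =>
      ∑ k : Finset.range m, if (k : ℕ) < i v then y k else 0) := by
    refine measurable_pi_lambda _ fun v => Finset.measurable_fun_sum _ fun k _ => ?_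
    split_ifs <;> fun_prop
  have hΨ : Measurable (fun (y : Finset.Ico m n → B) (v : J) =>
      ∑ k : Finset.Ico m n, if (k : ℕ) < j v then y k else 0) := by
    refine measurable_pi_lambda _ fun v => Finset.measurable_fun_sum _ fun k _ => ?_
    split_ifs <;> fun_prop
  convert key.comp hΦ hΨ using 1
  · ext ω v
    simp only [Function.comp]
    rw [Finset.sum_coe_sort (Finset.range m)
      (fun k => if k < i v then L (τ (k + 1)) ω - L (τ k) ω else 0), ← Finset.sum_filter]
    have : (Finset.range m).filter (fun k => k < i v) = Finset.range (i v) := by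
      ext k; have := him v; simp; omega
    rw [this, Finset.sum_range_sub (fun k => L (τ k) ω), hi, h0]
  · ext ω v
    simp only [Function.comp]
    rw [Finset.sum_coe_sort (Finset.Ico m n)
      (fun k => if k < j v then L (τ (k + 1)) ω - L (τ k) ω else 0), ← Finset.sum_filter]
    have : (Finset.Ico m n).filter (fun k => k < j v) = Finset.Ico m (j v) := by
      ext k; have := hjn v; simp; omega
    rw [this, Finset.sum_Ico_sub (fun k => L (τ k) ω) (hmj v), hj, hms]

/-- An element of `L²(Ω, 𝓕_t, P)` is almost everywhere a measurable function of the path of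
increments on `[0, t]`. -/
lemma exists_rep (hL : IsLevyProcess L P) (t : ℝ≥0) (g : levyFiber L P t) :
    ∃ G : (Set.Iic t → B) → ℂ, Measurable G ∧
      ((g : Lp ℂ 2 P) : Ω → ℂ) =ᵐ[P] G ∘ incrPath L 0 t := by
  obtain ⟨g', hg', hgg'⟩ := lpMeas.aestronglyMeasurable g
  rw [past_eq_comap] at hg'
  obtain ⟨G, hG, rfl⟩ := hg'.exists_eq_measurable_comp
  refine ⟨G, hG.measurable, hgg'.trans ?_⟩
  filter_upwards [hL.zero] with ω hω
  have h : (fun v : Set.Iic t => L v ω) = incrPath L 0 t ω := by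
    ext v
    simp [incrPath, hω]
  simp only [Function.comp, h]

/-- A measurable functional `G` of the path of increments on `[0, t]` that represents
`g ∈ L²(Ω, 𝓕_t, P)`. -/
noncomputable def rep (hL : IsLevyProcess L P) {t : ℝ≥0} (g : levyFiber L P t) :
    (Set.Iic t → B) → ℂ :=
  (hL.exists_rep t g).choose

lemma measurable_rep (hL : IsLevyProcess L P) {t : ℝ≥0} (g : levyFiber L P t) :
    Measurable (hL.rep g) :=
  (hL.exists_rep t g).choose_spec.1

lemma rep_ae_eq (hL : IsLevyProcess L P) {t : ℝ≥0} (g : levyFiber L P t) :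
    ((g : Lp ℂ 2 P) : Ω → ℂ) =ᵐ[P] hL.rep g ∘ incrPath L 0 t :=
  (hL.exists_rep t g).choose_spec.2

lemma memLp_rep_comp (hL : IsLevyProcess L P) (s : ℝ≥0) {t : ℝ≥0} (g : levyFiber L P t) :
    MemLp (hL.rep g ∘ incrPath L s t) 2 P := by
  have h := (hL.identDistrib_incrPath s t).comp (hL.measurable_rep g)
  exact h.memLp_iff.2 ((memLp_congr_ae (hL.rep_ae_eq g)).1 (Lp.memLp _))

/-- The shift operator `S_{s,t} : L²(Ω, 𝓕_t, P) → L²(Ω, 𝓕_{s,s+t}, P)`, which sends a functional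
`G((L_u)_{u ≤ t})` to `G((L_{s+u} - L_s)_{u ≤ t})`. -/
noncomputable def shift (hL : IsLevyProcess L P) (s : ℝ≥0) {t : ℝ≥0} (g : levyFiber L P t) :
    Lp ℂ 2 P :=
  (hL.memLp_rep_comp s g).toLp

/-- The shift does not depend on the functional that represents `g`. -/
lemma shift_ae_eq (hL : IsLevyProcess L P) (s : ℝ≥0) {t : ℝ≥0} (g : levyFiber L P t)
    {G : (Set.Iic t → B) → ℂ} (hG : Measurable G)
    (h : ((g : Lp ℂ 2 P) : Ω → ℂ) =ᵐ[P] G ∘ incrPath L 0 t) :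
    hL.shift s g =ᵐ[P] G ∘ incrPath L s t := by
  refine (MemLp.coeFn_toLp _).trans ?_
  have h1 : ∀ᵐ x ∂(P.map (incrPath L 0 t)), hL.rep g x = G x := by
    rw [ae_map_iff (hL.measurable_incrPath 0 t).aemeasurable
      (measurableSet_eq_fun (hL.measurable_rep g) hG)]
    exact (hL.rep_ae_eq g).symm.trans h
  rw [← (hL.identDistrib_incrPath s t).map_eq] at h1
  exact ae_of_ae_map (hL.measurable_incrPath s t).aemeasurable h1

lemma memLp_mul (hL : IsLevyProcess L P) {s t : ℝ≥0} (f : levyFiber L P s)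
    (g : levyFiber L P t) :
    MemLp (fun ω => ((f : Lp ℂ 2 P) : Ω → ℂ) ω * hL.shift s g ω) 2 P := by
  obtain ⟨f', hf', hff'⟩ := lpMeas.aestronglyMeasurable f
  have hg := hL.shift_ae_eq s g (hL.measurable_rep g) (hL.rep_ae_eq g)
  have hind : IndepFun f' (hL.rep g ∘ incrPath L s t) P := by
    rw [IndepFun_iff_Indep]
    refine indep_of_indep_of_le_left (indep_of_indep_of_le_right (hL.indep_incrPath s t) ?_)
      hf'.measurable.comap_le
    rw [← MeasurableSpace.comap_comp]
    exact MeasurableSpace.comap_mono (hL.measurable_rep g).comap_le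
  have hind' := (hind.congr hff'.symm hg.symm).comp (φ := fun z : ℂ => ‖z‖ ^ 2)
    (ψ := fun z : ℂ => ‖z‖ ^ 2) (by fun_prop) (by fun_prop)
  have hm : ∀ k : Lp ℂ 2 P, AEStronglyMeasurable (k : Ω → ℂ) P := Lp.aestronglyMeasurable
  refine (memLp_two_iff_integrable_sq_norm ((hm f).mul (hm (hL.shift s g)))).2 ?_
  have h1 := (memLp_two_iff_integrable_sq_norm (hm _)).1 (Lp.memLp (f : Lp ℂ 2 P))
  have h2 := (memLp_two_iff_integrable_sq_norm (hm _)).1 (Lp.memLp (hL.shift s g))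
  refine (hind'.integrable_mul h1 h2).congr (ae_of_all _ fun ω => ?_)
  simp [mul_pow]

lemma mul_mem (hL : IsLevyProcess L P) {s t : ℝ≥0} (f : levyFiber L P s) (g : levyFiber L P t) :
    (hL.memLp_mul f g).toLp ∈ levyFiber L P (s + t) := by
  rw [mem_lpMeas_iff_aestronglyMeasurable]
  have hf : AEStronglyMeasurable[past L (s + t)] ((f : Lp ℂ 2 P) : Ω → ℂ) P := by
    refine (lpMeas.aestronglyMeasurable f).mono ?_
    exact iSup_le fun v => (measurable_past (v.2.trans le_self_add)).comap_le
  have hg : AEStronglyMeasurable[past L (s + t)] (hL.shift s g : Ω → ℂ) P :=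
    ⟨hL.rep g ∘ incrPath L s t,
      ((hL.measurable_rep g).comp (measurable_incrPath_past s t)).stronglyMeasurable,
      hL.shift_ae_eq s g (hL.measurable_rep g) (hL.rep_ae_eq g)⟩
  exact (hf.mul hg).congr (MemLp.coeFn_toLp _).symm

/-- The product system `E^L` of a Lévy process: the fibres are `E(t) = L²(Ω, 𝓕_t, P)`, the total
space `{(t, f) | f ∈ E(t)}` has the Borel structure induced by `(0, ∞) × L²(Ω, P)`, and the product
of `f ∈ E(s)` and `g ∈ E(t)` is `f · S_{s,t} g`. -/
noncomputable def productSystem (hL : IsLevyProcess L P) : HilbertBundle.{u} where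
  Fiber t := levyFiber L P t
  borelStructure :=
    MeasurableSpace.comap (fun p => (p.1, (p.2 : Lp ℂ 2 P)))
      (MeasurableSpace.prod (inferInstance : MeasurableSpace PosTime) (borel (Lp ℂ 2 P)))
  mul f g := ⟨(hL.memLp_mul f g).toLp, hL.mul_mem f g⟩

end IsLevyProcess

end Levy

end ProductSystems

set_option linter.unusedSectionVars false

namespace ProductSystems

/-! ### Measurable orthonormal bases -/

/-! The increments after time `s` are independent of the past and have the law of the increments
after time `0`. Hence inner products multiply (`inner_mulFiber`), and associativity is the cocycle
identity for increments of increments (`mulFiber_assoc`).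

Everything else rests on the exponentials `exp (i ∑ φ_j(L_{u_j}))`. They have norm one, are stable
under products and shifts, and split at any intermediate time (`expo_split`). The explicit
characteristic function makes them continuous in `L²` as the times and the coefficients of the
functionals vary (`tendsto_expoLp_singleton`). They are total in `E(t)` by Fourier uniqueness for
finite-dimensional marginals (`setIntegral_eq_zero_of_integral_exp`). By continuity a countable
family suffices: functionals from a separating sequence, coefficients in `ℤ / (N + 1)`, times in the
grid of step `t / (N + 1)` (`topologicalClosure_span_labelFiber`).

Complete spatiality follows: `exp (i φ(L_t))` is a unit for every `φ`, and an exponential with times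
on a grid is a product of such units over the grid steps (`unitProduct_expoFiber`). Splitting at
time `s` also shows that products are dense.

For the Borel structure, the countable family consists of continuous sections, so Gram–Schmidt gives
orthonormal bases that depend measurably on `t` (`exists_measurable_hilbertBasis`); their coordinate
maps are the trivialization. Non-degeneracy of `Q` enters only to make the fibres
infinite-dimensional. Products of basis sections are jointly measurable because products of labelled
exponentials are continuous, and the general product is then a limit of finite bilinear expansions
(`measurable_mulFiber`). -/

/-- Since `ℕ` is discrete, `(n, z) ↦ F n z` is continuous in `n` and measurable in `z`, hence
jointly measurable. -/
lemma stronglyMeasurable_glue {Z X : Type*} [MeasurableSpace Z] [TopologicalSpace X]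
    [TopologicalSpace.PseudoMetrizableSpace X] {N : Z → ℕ} (hN : Measurable N) {F : ℕ → Z → X}
    (hF : ∀ n, StronglyMeasurable (F n)) : StronglyMeasurable fun z => F (N z) z :=
  (stronglyMeasurable_uncurry_of_continuous_of_stronglyMeasurable (u := F)
    (fun _ => continuous_of_discreteTopology) hF).comp_measurable (hN.prodMk measurable_id)

/-- A set of sections that is closed under sums, products with measurable functions and countable
measurable glueing. -/
structure IsSectionModule {T : Type*} [MeasurableSpace T] {K : T → Type*}
    [∀ t, NormedAddCommGroup (K t)] [∀ t, InnerProductSpace ℂ (K t)]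
    (A : Set (∀ t, K t)) : Prop where
  add : ∀ x ∈ A, ∀ y ∈ A, (fun t => x t + y t) ∈ A
  smul : ∀ c : T → ℂ, Measurable c → ∀ x ∈ A, (fun t => c t • x t) ∈ A
  glue : ∀ N : T → ℕ, Measurable N → ∀ x : ℕ → ∀ t, K t, (∀ n, x n ∈ A) →
    (fun t => x (N t) t) ∈ A

lemma IsSectionModule.sub {T : Type*} [MeasurableSpace T] {K : T → Type*}
    [∀ t, NormedAddCommGroup (K t)] [∀ t, InnerProductSpace ℂ (K t)]
    {A : Set (∀ t, K t)} (hA : IsSectionModule A) {x y : ∀ t, K t} (hx : x ∈ A) (hy : y ∈ A) :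
    (fun t => x t - y t) ∈ A := by
  convert hA.add x hx _ (hA.smul (fun _ => -1) measurable_const y hy) using 2 with t
  simp [sub_eq_add_neg]

lemma IsSectionModule.sum {T ι : Type*} [MeasurableSpace T] {K : T → Type*}
    [∀ t, NormedAddCommGroup (K t)] [∀ t, InnerProductSpace ℂ (K t)]
    {A : Set (∀ t, K t)} (hA : IsSectionModule A) (x₀ : ∀ t, K t) (hx₀ : x₀ ∈ A) (s : Finset ι)
    (x : ι → ∀ t, K t) (hx : ∀ i ∈ s, x i ∈ A) : (fun t => ∑ i ∈ s, x i t) ∈ A := by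
  classical
  induction s using Finset.induction_on with
  | empty =>
    convert hA.smul (fun _ => 0) measurable_const x₀ hx₀ using 2 with t
    simp
  | insert a s ha ih =>
    simp only [Finset.sum_insert ha]
    exact hA.add _ (hx a (by simp)) _ (ih fun i hi => hx i (by simp [hi]))

section Basis

variable {T H : Type*} [MeasurableSpace T] [NormedAddCommGroup H] [InnerProductSpace ℂ H]
  {K : T → Submodule ℂ H}

lemma isSectionModule_stronglyMeasurable :
    IsSectionModule {x : ∀ t, K t | StronglyMeasurable fun t => (x t : H)} where
  add x hx y hy := by
    exact StronglyMeasurable.add (f := fun t => (x t : H)) (g := fun t => (y t : H)) hx hy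
  smul c hc x hx := by
    exact StronglyMeasurable.smul (g := fun t => (x t : H)) hc.stronglyMeasurable hx
  glue N hN x hx := stronglyMeasurable_glue (F := fun n t => (x n t : H)) hN hx

/-- Each Gram–Schmidt vector is a finite combination of earlier ones with coefficients that are
measurable in `t`. The induction runs over all modules at once: measurability of the coefficients
needs the module of strongly measurable sections, whatever `A` is. -/
lemma gramSchmidt_mem_sectionModule {d : ℕ → ∀ t, K t}
    (hd : ∀ n, StronglyMeasurable fun t => (d n t : H)) {A : Set (∀ t, K t)}
    (hA : IsSectionModule A) (hdA : ∀ n, d n ∈ A) (n : ℕ) :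
    (fun t => InnerProductSpace.gramSchmidt ℂ (fun k => d k t) n) ∈ A := by
  induction n using Nat.strong_induction_on generalizing A with
  | _ n ih =>
    set g : ℕ → ∀ t, K t := fun i t => InnerProductSpace.gramSchmidt ℂ (fun k => d k t) i with hg
    have : g n = fun t => d n t -
        ∑ i ∈ Finset.Iio n, (⟪g i t, d n t⟫_ℂ / ((‖g i t‖ : ℂ) ^ 2)) • g i t := by
      ext1 t
      rw [eq_sub_iff_add_eq]
      exact (InnerProductSpace.gramSchmidt_def'' ℂ (fun k => d k t) n).symm
    change g n ∈ A
    rw [this]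
    -- `d 0` serves only to produce the zero section, for the empty sum.
    refine hA.sub (hdA n) (hA.sum _ (hdA 0) _ _ fun i hi => ?_)
    rw [Finset.mem_Iio] at hi
    refine hA.smul _ ?_ _ (ih i hi hA hdA)
    have hm : StronglyMeasurable fun t => (g i t : H) :=
      ih i hi isSectionModule_stronglyMeasurable hd
    exact (StronglyMeasurable.inner (𝕜 := ℂ) hm (hd n)).measurable.div
      ((Complex.measurable_ofReal.comp hm.norm.measurable).pow_const 2)

/-- The `k`-th index is `n` exactly when `p t n` holds and `k` smaller indices satisfy `p t`; that
count is a finite sum of indicators. -/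
lemma measurable_nth {p : T → ℕ → Prop} (hp : ∀ n, MeasurableSet {t | p t n})
    (hinf : ∀ t, {n | p t n}.Infinite) (k : ℕ) : Measurable fun t => Nat.nth (p t) k := by
  classical
  have hc : ∀ n, Measurable fun t => Nat.count (p t) n := fun n => by
    induction n with
    | zero => simp
    | succ n ih =>
      simp only [Nat.count_succ]
      exact ih.add (Measurable.ite (hp n) measurable_const measurable_const)
  refine measurable_to_countable' fun n => ?_
  have : (fun t => Nat.nth (p t) k) ⁻¹' {n} = {t | p t n} ∩ {t | Nat.count (p t) n = k} := by
    ext t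
    simp only [Set.mem_preimage, Set.mem_singleton_iff, Set.mem_inter_iff, Set.mem_ofPred_eq]
    constructor
    · rintro rfl
      exact ⟨Nat.nth_mem_of_infinite (hinf t) k, Nat.count_nth_of_infinite (hinf t) k⟩
    · rintro ⟨h1, rfl⟩
      exact Nat.nth_count h1
  rw [this]
  exact (hp n).inter (hc n (measurableSet_singleton k))

/-- A family of closed subspaces with a total sequence of measurable sections has orthonormal bases
that are measurable sections. -/
theorem exists_measurable_hilbertBasis [∀ t, CompleteSpace (K t)] {d : ℕ → ∀ t, K t}
    (hd : ∀ n, StronglyMeasurable fun t => (d n t : H))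
    (hdense : ∀ t, (Submodule.span ℂ (Set.range fun n => d n t)).topologicalClosure = ⊤)
    (hinf : ∀ t, ¬ FiniteDimensional ℂ (K t)) :
    ∃ e : ∀ t, HilbertBasis ℕ ℂ (K t), ∀ A : Set (∀ t, K t), IsSectionModule A →
      (∀ n, d n ∈ A) → ∀ n, (fun t => e t n) ∈ A := by
  set g : ℕ → ∀ t, K t := fun n t => InnerProductSpace.gramSchmidtNormed ℂ (fun k => d k t) n
    with hg
  have hgA : ∀ A : Set (∀ t, K t), IsSectionModule A → (∀ n, d n ∈ A) → ∀ n, g n ∈ A := by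
    intro A hA hdA n
    have hm := gramSchmidt_mem_sectionModule hd isSectionModule_stronglyMeasurable hd n
    exact hA.smul _ (Complex.measurable_ofReal.comp (StronglyMeasurable.norm hm).measurable).inv _
      (gramSchmidt_mem_sectionModule hd hA hdA n)
  have hgm : ∀ n, StronglyMeasurable fun t => (g n t : H) :=
    hgA _ isSectionModule_stronglyMeasurable hd
  have hspan : ∀ t, Submodule.span ℂ (Set.range fun n => g n t) =
      Submodule.span ℂ (Set.range fun n => d n t) := fun t => by
    rw [InnerProductSpace.span_gramSchmidtNormed_range, InnerProductSpace.span_gramSchmidt]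
  -- Finitely many non-zero vectors would span a closed finite-dimensional subspace, which is dense
  -- and hence the whole fibre.
  have hne : ∀ t, {n | g n t ≠ 0}.Infinite := by
    intro t hfin
    refine hinf t ?_
    have h1 : (Set.range fun n => g n t) ⊆ insert 0 ((fun n => g n t) '' {n | g n t ≠ 0}) := by
      rintro _ ⟨n, rfl⟩
      by_cases h : g n t = 0
      · simp [h]
      · exact Or.inr ⟨n, h, rfl⟩
    have h2 : (Set.range fun n => g n t).Finite := ((hfin.image _).insert 0).subset h1
    have h3 := FiniteDimensional.span_of_finite ℂ h2
    have h4 := (Submodule.closed_of_finiteDimensional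
      (Submodule.span ℂ (Set.range fun n => g n t))).submodule_topologicalClosure_eq
    rw [hspan t, hdense t, ← hspan t] at h4
    rw [← h4] at h3
    exact Module.finite_def.2 (Module.Finite.iff_fg.1 h3)
  -- Gram–Schmidt returns zero at linearly dependent vectors, at places that vary with `t`; the
  -- basis keeps the non-zero vectors in order.
  set idx : ℕ → T → ℕ := fun k t => Nat.nth (fun n => g n t ≠ 0) k
  have hidx : ∀ k, Measurable (idx k) := measurable_nth (fun n => by
    have : Measurable fun t => ‖(g n t : H)‖ := (hgm n).norm.measurable
    convert (this (measurableSet_singleton 0)).compl using 1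
    ext t; simp) hne
  have hon : ∀ t, Orthonormal ℂ fun k => g (idx k t) t := fun t =>
    (InnerProductSpace.gramSchmidtNormed_orthonormal' (fun k => d k t)).comp
      (fun k => (⟨idx k t, Nat.nth_mem_of_infinite (hne t) k⟩ : {n // g n t ≠ 0}))
      fun i j hij => Nat.nth_injective (hne t) (congrArg Subtype.val hij)
  have htot : ∀ t, ⊤ ≤ (Submodule.span ℂ (Set.range fun k => g (idx k t) t)).topologicalClosure := by
    intro t
    rw [← hdense t, ← hspan t]
    refine Submodule.topologicalClosure_mono (Submodule.span_le.2 ?_)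
    rintro _ ⟨n, rfl⟩
    by_cases h : g n t = 0
    · simp [h]
    · obtain ⟨k, hk⟩ : n ∈ Set.range (Nat.nth fun n => g n t ≠ 0) := by
        rw [Nat.range_nth_of_infinite (hne t)]; exact h
      refine Submodule.subset_span ⟨k, ?_⟩
      simp only [idx, hk]
  refine ⟨fun t => HilbertBasis.mk (hon t) (htot t), fun A hA hdA n => ?_⟩
  simp only [HilbertBasis.coe_mk]
  exact hA.glue (idx n) (hidx n) g (hgA A hA hdA)

end Basis

/-! ### Measurability of coordinates and of expansions in a measurable basis. -/

section Trivialization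

variable {T H : Type*} [MeasurableSpace T] [NormedAddCommGroup H] [InnerProductSpace ℂ H]
  {K : T → Submodule ℂ H}

/-- `H` need not be separable, so continuity of the inner product does not give measurability for
the product σ-algebra on `H × H`. Approximating `v` by simple functions leaves one fixed vector at a
time. -/
lemma measurable_inner_of_stronglyMeasurable [MeasurableSpace H] [BorelSpace H] {v : T → H}
    (hv : StronglyMeasurable v) : Measurable fun p : T × H => ⟪v p.1, p.2⟫_ℂ := by
  refine measurable_of_tendsto_metrizable
    (f := fun n (p : T × H) => ⟪hv.approx n p.1, p.2⟫_ℂ) (fun n => ?_) ?_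
  · exact ((hv.approx n).comp Prod.fst measurable_fst).measurable_bind
      (fun b (p : T × H) => ⟪b, p.2⟫_ℂ)
      fun b => (Continuous.measurable (by fun_prop : Continuous fun x : H => ⟪b, x⟫_ℂ)).comp
        measurable_snd
  · rw [tendsto_pi_nhds]
    intro p
    exact (hv.tendsto_approx p.1).inner tendsto_const_nhds

lemma measurable_inner_section [MeasurableSpace H] [BorelSpace H] {v : ∀ t, K t}
    (hv : StronglyMeasurable fun t => (v t : H)) {m : MeasurableSpace (Σ t, K t)}
    (hm : Measurable fun p : Σ t, K t => (p.1, (p.2 : H))) :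
    Measurable fun p : Σ t, K t => ⟪(v p.1 : H), (p.2 : H)⟫_ℂ :=
  (measurable_inner_of_stronglyMeasurable hv).comp hm

lemma measurable_repr [MeasurableSpace H] [BorelSpace H] [MeasurableSpace HilbertBundle.EllTwo]
    [BorelSpace HilbertBundle.EllTwo] {e : ∀ t, HilbertBasis ℕ ℂ (K t)}
    (he : ∀ n, StronglyMeasurable fun t => (e t n : H)) {m : MeasurableSpace (Σ t, K t)}
    (hm : Measurable fun p : Σ t, K t => (p.1, (p.2 : H))) :
    Measurable fun p : Σ t, K t => (e p.1).repr p.2 := by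
  refine StronglyMeasurable.measurable (stronglyMeasurable_of_tendsto atTop
    (f := fun N (p : Σ t, K t) => ∑ n ∈ Finset.range N, ⟪e p.1 n, p.2⟫_ℂ •
      (lp.single 2 n 1 : HilbertBundle.EllTwo)) (fun N => ?_) ?_)
  · refine Finset.stronglyMeasurable_fun_sum _ fun n _ => ?_
    refine StronglyMeasurable.smul_const (Measurable.stronglyMeasurable ?_) _
    exact measurable_inner_section (he n) hm
  · rw [tendsto_pi_nhds]
    intro p
    have h := (lp.hasSum_single (E := fun _ : ℕ => ℂ) (p := 2) (by simp)
      ((e p.1).repr p.2)).tendsto_sum_nat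
    convert h using 4 with N n
    rw [HilbertBasis.repr_apply_apply, ← lp.single_smul]
    simp

lemma stronglyMeasurable_repr_symm [MeasurableSpace HilbertBundle.EllTwo]
    [BorelSpace HilbertBundle.EllTwo] {e : ∀ t, HilbertBasis ℕ ℂ (K t)}
    (he : ∀ n, StronglyMeasurable fun t => (e t n : H)) :
    StronglyMeasurable fun q : T × HilbertBundle.EllTwo => ((e q.1).repr.symm q.2 : H) := by
  refine stronglyMeasurable_of_tendsto atTop
    (f := fun N (q : T × HilbertBundle.EllTwo) => ∑ n ∈ Finset.range N, q.2 n • (e q.1 n : H))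
    (fun N => ?_) ?_
  · refine Finset.stronglyMeasurable_fun_sum _ fun n _ => ?_
    refine StronglyMeasurable.smul (Measurable.stronglyMeasurable ?_)
      ((he n).comp_measurable measurable_fst)
    exact (lp.evalCLM (𝕜 := ℂ) (E := fun _ : ℕ => ℂ) (p := 2) n).continuous.measurable.comp
      measurable_snd
  · rw [tendsto_pi_nhds]
    intro q
    have h := ((continuous_subtype_val.tendsto _).comp
      ((e q.1).hasSum_repr_symm q.2).tendsto_sum_nat)
    convert h using 2 with N
    simp

end Trivialization

namespace IsLevyProcess

variable {Ω : Type u} {B : Type*} [MeasurableSpace Ω] [NormedAddCommGroup B]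
  [MeasurableSpace B] [SecondCountableTopology B] [BorelSpace B]
  {L : ℝ≥0 → Ω → B} {P : Measure Ω} [IsProbabilityMeasure P]

/-! ### Algebra of the multiplication -/

/-- The product `f · S_{s,t} g` with real times. -/
noncomputable def mulFiber (hL : IsLevyProcess L P) {s t : ℝ≥0} (f : levyFiber L P s)
    (g : levyFiber L P t) : levyFiber L P (s + t) :=
  ⟨(hL.memLp_mul f g).toLp, hL.mul_mem f g⟩

/-- Frees later computations from the chosen functional `rep`: any version of `f` and any functional
representing `g` may be used. -/
lemma mulFiber_ae_eq (hL : IsLevyProcess L P) {s t : ℝ≥0} (f : levyFiber L P s)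
    (g : levyFiber L P t) {F : Ω → ℂ} {G : (Set.Iic t → B) → ℂ}
    (hF : ((f : Lp ℂ 2 P) : Ω → ℂ) =ᵐ[P] F) (hG : Measurable G)
    (hg : ((g : Lp ℂ 2 P) : Ω → ℂ) =ᵐ[P] G ∘ incrPath L 0 t) :
    ((hL.mulFiber f g : Lp ℂ 2 P) : Ω → ℂ) =ᵐ[P] fun ω => F ω * G (incrPath L s t ω) := by
  refine (MemLp.coeFn_toLp (hL.memLp_mul f g)).trans ?_
  filter_upwards [hF, hL.shift_ae_eq s g hG hg] with ω h1 h2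
  rw [h1, h2]
  rfl

lemma mulFiber_ae_eq_rep (hL : IsLevyProcess L P) {s t : ℝ≥0} (f : levyFiber L P s)
    (g : levyFiber L P t) : ((hL.mulFiber f g : Lp ℂ 2 P) : Ω → ℂ) =ᵐ[P]
      fun ω => hL.rep f (incrPath L 0 s ω) * hL.rep g (incrPath L s t ω) :=
  hL.mulFiber_ae_eq f g (hL.rep_ae_eq f) (hL.measurable_rep g) (hL.rep_ae_eq g)

lemma levyFiber_ext {t : ℝ≥0} {f g : levyFiber L P t}
    (h : ((f : Lp ℂ 2 P) : Ω → ℂ) =ᵐ[P] ((g : Lp ℂ 2 P) : Ω → ℂ)) : f = g :=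
  Subtype.ext (Lp.ext h)

lemma add_mulFiber (hL : IsLevyProcess L P) {s t : ℝ≥0} (f f' : levyFiber L P s)
    (g : levyFiber L P t) : hL.mulFiber (f + f') g = hL.mulFiber f g + hL.mulFiber f' g := by
  refine levyFiber_ext ?_
  filter_upwards [hL.mulFiber_ae_eq (f + f') g (Lp.coeFn_add (f : Lp ℂ 2 P) f')
      (hL.measurable_rep g) (hL.rep_ae_eq g),
    hL.mulFiber_ae_eq f g EventuallyEq.rfl (hL.measurable_rep g) (hL.rep_ae_eq g),
    hL.mulFiber_ae_eq f' g EventuallyEq.rfl (hL.measurable_rep g) (hL.rep_ae_eq g),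
    Lp.coeFn_add (hL.mulFiber f g : Lp ℂ 2 P) (hL.mulFiber f' g)] with ω h1 h2 h3 h4
  rw [Submodule.coe_add, h4, h1, Pi.add_apply, Pi.add_apply, h2, h3, add_mul]

lemma smul_mulFiber (hL : IsLevyProcess L P) {s t : ℝ≥0} (c : ℂ) (f : levyFiber L P s)
    (g : levyFiber L P t) : hL.mulFiber (c • f) g = c • hL.mulFiber f g := by
  refine levyFiber_ext ?_
  filter_upwards [hL.mulFiber_ae_eq (c • f) g (Lp.coeFn_smul c (f : Lp ℂ 2 P))
      (hL.measurable_rep g) (hL.rep_ae_eq g),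
    hL.mulFiber_ae_eq f g EventuallyEq.rfl (hL.measurable_rep g) (hL.rep_ae_eq g),
    Lp.coeFn_smul c (hL.mulFiber f g : Lp ℂ 2 P)] with ω h1 h2 h4
  rw [Submodule.coe_smul, h4, h1, Pi.smul_apply, Pi.smul_apply, h2, smul_mul_assoc]

lemma mulFiber_add (hL : IsLevyProcess L P) {s t : ℝ≥0} (f : levyFiber L P s)
    (g g' : levyFiber L P t) : hL.mulFiber f (g + g') = hL.mulFiber f g + hL.mulFiber f g' := by
  have h : ((g + g' : levyFiber L P t) : Lp ℂ 2 P) =ᵐ[P]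
      (hL.rep g + hL.rep g') ∘ incrPath L 0 t := by
    filter_upwards [Lp.coeFn_add (g : Lp ℂ 2 P) g', hL.rep_ae_eq g, hL.rep_ae_eq g']
      with ω h1 h2 h3
    rw [Submodule.coe_add, h1, Pi.add_apply, h2, h3]
    rfl
  refine levyFiber_ext ?_
  filter_upwards [hL.mulFiber_ae_eq f (g + g') (hL.rep_ae_eq f)
      ((hL.measurable_rep g).add (hL.measurable_rep g')) h,
    hL.mulFiber_ae_eq_rep f g, hL.mulFiber_ae_eq_rep f g',
    Lp.coeFn_add (hL.mulFiber f g : Lp ℂ 2 P) (hL.mulFiber f g')] with ω h1 h2 h3 h4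
  rw [Submodule.coe_add, h4, h1, Pi.add_apply, Pi.add_apply, h2, h3, mul_add]
  rfl

lemma mulFiber_smul (hL : IsLevyProcess L P) {s t : ℝ≥0} (c : ℂ) (f : levyFiber L P s)
    (g : levyFiber L P t) : hL.mulFiber f (c • g) = c • hL.mulFiber f g := by
  have h : ((c • g : levyFiber L P t) : Lp ℂ 2 P) =ᵐ[P] (c • hL.rep g) ∘ incrPath L 0 t := by
    filter_upwards [Lp.coeFn_smul c (g : Lp ℂ 2 P), hL.rep_ae_eq g] with ω h1 h2
    rw [Submodule.coe_smul, h1, Pi.smul_apply, h2]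
    rfl
  refine levyFiber_ext ?_
  filter_upwards [hL.mulFiber_ae_eq f (c • g) (hL.rep_ae_eq f)
      ((hL.measurable_rep g).const_smul c) h,
    hL.mulFiber_ae_eq_rep f g, Lp.coeFn_smul c (hL.mulFiber f g : Lp ℂ 2 P)] with ω h1 h2 h4
  rw [Submodule.coe_smul, h4, h1, Pi.smul_apply, Pi.smul_apply, h2, mul_smul_comm]
  rfl

/-- The integrand is a function of the path up to `s` times a function of the increments after `s`.
Independence factors the expectation, and stationarity turns the second factor into `⟪g, g'⟫`. -/
lemma inner_mulFiber (hL : IsLevyProcess L P) {s t : ℝ≥0} (f f' : levyFiber L P s)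
    (g g' : levyFiber L P t) :
    ⟪hL.mulFiber f g, hL.mulFiber f' g'⟫_ℂ = ⟪f, f'⟫_ℂ * ⟪g, g'⟫_ℂ := by
  simp only [Submodule.coe_inner, L2.inner_def]
  set U : (Set.Iic s → B) → ℂ := fun p => ⟪hL.rep f p, hL.rep f' p⟫_ℂ with hU
  set W : (Set.Iic t → B) → ℂ := fun p => ⟪hL.rep g p, hL.rep g' p⟫_ℂ with hW
  have hUm : Measurable U := (hL.measurable_rep f).inner (hL.measurable_rep f')
  have hWm : Measurable W := (hL.measurable_rep g).inner (hL.measurable_rep g')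
  have e1 : ∫ ω, ⟪(hL.mulFiber f g : Lp ℂ 2 P) ω, (hL.mulFiber f' g' : Lp ℂ 2 P) ω⟫_ℂ ∂P =
      ∫ ω, U (incrPath L 0 s ω) * W (incrPath L s t ω) ∂P := by
    refine integral_congr_ae ?_
    filter_upwards [hL.mulFiber_ae_eq_rep f g, hL.mulFiber_ae_eq_rep f' g'] with ω h1 h2
    rw [h1, h2]
    simp only [hU, hW, RCLike.inner_apply, map_mul]
    ring
  have e2 : ∫ ω, ⟪(f : Lp ℂ 2 P) ω, (f' : Lp ℂ 2 P) ω⟫_ℂ ∂P = ∫ ω, U (incrPath L 0 s ω) ∂P := by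
    refine integral_congr_ae ?_
    filter_upwards [hL.rep_ae_eq f, hL.rep_ae_eq f'] with ω h1 h2
    rw [h1, h2]
    rfl
  have e3 : ∫ ω, ⟪(g : Lp ℂ 2 P) ω, (g' : Lp ℂ 2 P) ω⟫_ℂ ∂P = ∫ ω, W (incrPath L s t ω) ∂P := by
    refine Eq.trans ?_ ((hL.identDistrib_incrPath s t).comp hWm).integral_eq.symm
    refine integral_congr_ae ?_
    filter_upwards [hL.rep_ae_eq g, hL.rep_ae_eq g'] with ω h1 h2
    rw [h1, h2]
    rfl
  have hind : IndepFun (fun ω => U (incrPath L 0 s ω)) (fun ω => W (incrPath L s t ω)) P := by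
    rw [IndepFun_iff_Indep]
    refine indep_of_indep_of_le_left (indep_of_indep_of_le_right (hL.indep_incrPath s t) ?_) ?_
    · exact (hWm.comp (comap_measurable _)).comap_le
    · have h0 : Measurable[past L s] (incrPath L 0 s) := by
        have h := measurable_incrPath_past (L := L) 0 s
        rwa [zero_add] at h
      exact (hUm.comp h0).comap_le
  rw [e1, e2, e3]
  exact hind.integral_fun_mul_eq_mul_integral
    (hUm.comp (hL.measurable_incrPath 0 s)).aestronglyMeasurable
    (hWm.comp (hL.measurable_incrPath s t)).aestronglyMeasurable

lemma norm_mulFiber (hL : IsLevyProcess L P) {s t : ℝ≥0} (f : levyFiber L P s)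
    (g : levyFiber L P t) : ‖hL.mulFiber f g‖ = ‖f‖ * ‖g‖ := by
  have h := hL.inner_mulFiber f f g g
  simp only [Submodule.coe_inner] at h
  rw [inner_self_eq_norm_sq_to_K, inner_self_eq_norm_sq_to_K, inner_self_eq_norm_sq_to_K] at h
  have h' : ‖hL.mulFiber f g‖ ^ 2 = (‖f‖ * ‖g‖) ^ 2 := by
    rw [mul_pow]
    exact_mod_cast h
  exact (sq_eq_sq₀ (norm_nonneg _) (by positivity)).1 h'

/-- The multiplication as a bounded bilinear map. -/
noncomputable def mulCLM (hL : IsLevyProcess L P) (s t : ℝ≥0) :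
    levyFiber L P s →L[ℂ] levyFiber L P t →L[ℂ] levyFiber L P (s + t) :=
  LinearMap.mkContinuous₂
    (LinearMap.mk₂ ℂ hL.mulFiber hL.add_mulFiber hL.smul_mulFiber hL.mulFiber_add
      hL.mulFiber_smul) 1 fun f g => by simp [hL.norm_mulFiber]

lemma mulFiber_assoc (hL : IsLevyProcess L P) {r s t : ℝ≥0} (f : levyFiber L P r)
    (g : levyFiber L P s) (h : levyFiber L P t) :
    (hL.mulFiber f (hL.mulFiber g h) : Lp ℂ 2 P) = hL.mulFiber (hL.mulFiber f g) h := by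
  -- A functional on paths over `[0, s + t]` that represents `g h`: the restriction to `[0, s]`
  -- feeds `g`, and the increments after `s` feed `h`.
  set G : (Set.Iic (s + t) → B) → ℂ := fun p =>
    hL.rep g (fun v => p ⟨v, Set.mem_Iic.2 (v.2.trans le_self_add)⟩) *
      hL.rep h (fun v => p ⟨s + v, add_le_add_right v.2 s⟩ - p ⟨s, Set.mem_Iic.2 le_self_add⟩) with hG
  have hGm : Measurable G := by
    refine ((hL.measurable_rep g).comp ?_).mul ((hL.measurable_rep h).comp ?_) <;> fun_prop
  have hG' : ((hL.mulFiber g h : Lp ℂ 2 P) : Ω → ℂ) =ᵐ[P] G ∘ incrPath L 0 (s + t) := by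
    filter_upwards [hL.mulFiber_ae_eq_rep g h] with ω hω
    rw [hω]
    simp only [hG, Function.comp, incrPath]
    congr 2
    ext v
    simp [incrPath]
  refine Lp.ext ?_
  filter_upwards [hL.mulFiber_ae_eq f (hL.mulFiber g h) EventuallyEq.rfl hGm hG',
    hL.mulFiber_ae_eq (hL.mulFiber f g) h (hL.mulFiber_ae_eq f g EventuallyEq.rfl
      (hL.measurable_rep g) (hL.rep_ae_eq g)) (hL.measurable_rep h) (hL.rep_ae_eq h)] with ω h1 h2
  rw [h1, h2, mul_assoc]
  simp only [hG, incrPath]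
  congr 3
  ext v
  simp [incrPath, add_assoc]

end IsLevyProcess

/-! ### Exponentials of the process -/

section Expo

variable {B : Type*} [NormedAddCommGroup B] [NormedSpace ℝ B]

/-- The functional `exp (i ∑ φ_j(x(u_j)))` of a path `x`, for a list of pairs `(φ_j, u_j)`. -/
noncomputable def expo (l : List (StrongDual ℝ B × ℝ≥0)) (x : ℝ≥0 → B) : ℂ :=
  Complex.exp (Complex.I * ((l.map fun p => p.1 (x p.2)).sum : ℝ))

@[simp]
lemma expo_nil (x : ℝ≥0 → B) : expo [] x = 1 := by simp [expo]

lemma expo_cons (p : StrongDual ℝ B × ℝ≥0) (l : List (StrongDual ℝ B × ℝ≥0)) (x : ℝ≥0 → B) :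
    expo (p :: l) x = expo [p] x * expo l x := by
  simp [expo, mul_add, Complex.exp_add]

lemma expo_singleton (p : StrongDual ℝ B × ℝ≥0) (x : ℝ≥0 → B) :
    expo [p] x = Complex.exp (Complex.I * (p.1 (x p.2) : ℝ)) := by simp [expo]

lemma expo_append (l l' : List (StrongDual ℝ B × ℝ≥0)) (x : ℝ≥0 → B) :
    expo (l ++ l') x = expo l x * expo l' x := by
  simp [expo, mul_add, Complex.exp_add]

lemma norm_expo (l : List (StrongDual ℝ B × ℝ≥0)) (x : ℝ≥0 → B) : ‖expo l x‖ = 1 := by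
  rw [expo, mul_comm]
  exact Complex.norm_exp_ofReal_mul_I _

lemma expo_congr {l : List (StrongDual ℝ B × ℝ≥0)} {x y : ℝ≥0 → B}
    (h : ∀ p ∈ l, x p.2 = y p.2) : expo l x = expo l y := by
  unfold expo
  congr 4
  exact List.map_congr_left fun p hp => by rw [h p hp]

/-- The part of a list of pairs `(φ, u)` up to time `s`. -/
def beforeTime (s : ℝ≥0) (l : List (StrongDual ℝ B × ℝ≥0)) : List (StrongDual ℝ B × ℝ≥0) :=
  l.map fun p => (p.1, min p.2 s)

/-- The part of a list of pairs `(φ, u)` after time `s`. -/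
noncomputable def afterTime (s : ℝ≥0) (l : List (StrongDual ℝ B × ℝ≥0)) :
    List (StrongDual ℝ B × ℝ≥0) :=
  l.map fun p => (p.1, p.2 - s)

lemma beforeTime_le (s : ℝ≥0) (l : List (StrongDual ℝ B × ℝ≥0)) :
    ∀ p ∈ beforeTime s l, p.2 ≤ s := by
  simp only [beforeTime, List.mem_map]
  rintro _ ⟨p, -, rfl⟩
  exact min_le_right _ _

lemma afterTime_le {s t : ℝ≥0} {l : List (StrongDual ℝ B × ℝ≥0)} (h : ∀ p ∈ l, p.2 ≤ s + t) :
    ∀ p ∈ afterTime s l, p.2 ≤ t := by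
  simp only [afterTime, List.mem_map]
  rintro _ ⟨p, hp, rfl⟩
  exact tsub_le_iff_left.2 (h p hp)

/-- Telescoping: `x u = x (min u s) + (x (s + (u - s)) - x s)`. Truncated subtraction makes the
bracket vanish when `u ≤ s`. -/
lemma expo_split (s : ℝ≥0) (l : List (StrongDual ℝ B × ℝ≥0)) (x : ℝ≥0 → B) :
    expo l x = expo (beforeTime s l) x * expo (afterTime s l) fun v => x (s + v) - x s := by
  induction l with
  | nil => simp [beforeTime, afterTime]
  | cons p l ih =>
    have hb : beforeTime s (p :: l) = (p.1, min p.2 s) :: beforeTime s l := rfl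
    have ha : afterTime s (p :: l) = (p.1, p.2 - s) :: afterTime s l := rfl
    rw [expo_cons, ih, hb, ha, expo_cons _ (beforeTime s l), expo_cons _ (afterTime s l)]
    have : expo [p] x = expo [(p.1, min p.2 s)] x *
        expo [(p.1, p.2 - s)] fun v => x (s + v) - x s := by
      simp only [expo_singleton, ← Complex.exp_add, ← mul_add]
      rcases le_total p.2 s with h | h
      · simp [min_eq_left h, tsub_eq_zero_of_le h]
      · simp [min_eq_right h, add_tsub_cancel_of_le h]
    rw [this]
    ring

/-- The list of pairs with `expo (translate s l) x = expo l (x (s + ·) - x s)`. -/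
def translate (s : ℝ≥0) (l : List (StrongDual ℝ B × ℝ≥0)) : List (StrongDual ℝ B × ℝ≥0) :=
  (l.map fun p => (p.1, s + p.2)) ++ l.map fun p => (-p.1, s)

lemma expo_translate (s : ℝ≥0) (l : List (StrongDual ℝ B × ℝ≥0)) (x : ℝ≥0 → B) :
    expo (translate s l) x = expo l fun v => x (s + v) - x s := by
  unfold translate
  induction l with
  | nil => simp
  | cons p l ih =>
    rw [expo_cons p l, ← ih]
    simp only [List.map_cons, expo_append, expo_cons _ (List.map _ _)]
    have : expo [p] (fun v => x (s + v) - x s) = expo [(p.1, s + p.2)] x * expo [(-p.1, s)] x := by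
      simp only [expo_singleton, ← Complex.exp_add, ← mul_add]
      simp [sub_eq_add_neg]
    rw [this]
    ring

lemma measurable_expo {Ω : Type*} {m : MeasurableSpace Ω} [MeasurableSpace B] [BorelSpace B]
    {L : ℝ≥0 → Ω → B} {l : List (StrongDual ℝ B × ℝ≥0)} (h : ∀ p ∈ l, Measurable (L p.2)) :
    Measurable fun ω => expo l fun u => L u ω := by
  induction l with
  | nil => simp
  | cons p l ih =>
    simp_rw [expo_cons p l, expo_singleton]
    refine Measurable.mul ?_ (ih fun q hq => h q (by simp [hq]))
    exact Complex.measurable_exp.comp ((Complex.measurable_ofReal.comp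
      (p.1.continuous.measurable.comp (h p (by simp)))).const_mul _)

end Expo

namespace IsLevyProcess

variable {Ω : Type u} {B : Type*} [MeasurableSpace Ω] [NormedAddCommGroup B] [NormedSpace ℝ B]
  [MeasurableSpace B] [SecondCountableTopology B] [BorelSpace B]
  {L : ℝ≥0 → Ω → B} {P : Measure Ω} [IsProbabilityMeasure P]

lemma memLp_expo (hL : IsLevyProcess L P) (l : List (StrongDual ℝ B × ℝ≥0)) :
    MemLp (fun ω => expo l fun u => L u ω) 2 P :=
  MemLp.of_bound (measurable_expo fun p _ => hL.measurable p.2).aestronglyMeasurable 1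
    (ae_of_all _ fun _ => (norm_expo l _).le)

/-- The class of `exp (i ∑ φ_j(L_{u_j}))` in `L²`. -/
noncomputable def expoLp (hL : IsLevyProcess L P) (l : List (StrongDual ℝ B × ℝ≥0)) : Lp ℂ 2 P :=
  (hL.memLp_expo l).toLp

lemma expoLp_ae_eq (hL : IsLevyProcess L P) (l : List (StrongDual ℝ B × ℝ≥0)) :
    hL.expoLp l =ᵐ[P] fun ω => expo l fun u => L u ω :=
  MemLp.coeFn_toLp _

lemma expoLp_mem (hL : IsLevyProcess L P) {l : List (StrongDual ℝ B × ℝ≥0)} {t : ℝ≥0}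
    (h : ∀ p ∈ l, p.2 ≤ t) : hL.expoLp l ∈ levyFiber L P t := by
  rw [mem_lpMeas_iff_aestronglyMeasurable]
  exact ⟨_, (measurable_expo fun p hp => measurable_past (h p hp)).stronglyMeasurable,
    hL.expoLp_ae_eq l⟩

/-- The class of `exp (i ∑ φ_j(L_{u_j}))`, where `u_j ≤ t`, in `E(t)`. -/
noncomputable def expoFiber (hL : IsLevyProcess L P) (t : ℝ≥0)
    (l : List (StrongDual ℝ B × ℝ≥0)) (h : ∀ p ∈ l, p.2 ≤ t) : levyFiber L P t :=
  ⟨hL.expoLp l, hL.expoLp_mem h⟩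

lemma mulFiber_expoFiber_ae_eq (hL : IsLevyProcess L P) {s t : ℝ≥0} (f : levyFiber L P s)
    (l : List (StrongDual ℝ B × ℝ≥0)) (h : ∀ p ∈ l, p.2 ≤ t) :
    ((hL.mulFiber f (hL.expoFiber t l h) : Lp ℂ 2 P) : Ω → ℂ) =ᵐ[P]
      fun ω => (f : Lp ℂ 2 P) ω * expo l fun v => L (s + v) ω - L s ω := by
  -- The truncation `min u t` only makes the functional well defined on paths over `[0, t]`; all
  -- times in `l` are at most `t`.
  set G : (Set.Iic t → B) → ℂ := fun x => expo l fun u => x ⟨min u t, Set.mem_Iic.2 (min_le_right _ _)⟩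
    with hG
  have hGm : Measurable G :=
    measurable_expo (L := fun u (x : Set.Iic t → B) => x ⟨min u t, Set.mem_Iic.2 (min_le_right _ _)⟩)
      fun p _ => measurable_pi_apply _
  refine (hL.mulFiber_ae_eq f (hL.expoFiber t l h) EventuallyEq.rfl hGm ?_).trans
    (ae_of_all _ fun ω => ?_)
  · filter_upwards [hL.expoLp_ae_eq l, hL.zero] with ω h1 h2
    have h3 : (expo l fun u => L u ω) = G (incrPath L 0 t ω) :=
      expo_congr fun p hp => by simp [incrPath, h2, h p hp]
    exact h1.trans h3
  · have h3 : G (incrPath L s t ω) = expo l fun v => L (s + v) ω - L s ω :=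
      expo_congr fun p hp => by simp [incrPath, h p hp]
    simp only [h3]

/-- Reduces continuity of products in the two times to continuity of a single exponential. -/
lemma mulFiber_expoFiber (hL : IsLevyProcess L P) {s t : ℝ≥0}
    (l l' : List (StrongDual ℝ B × ℝ≥0)) (h : ∀ p ∈ l, p.2 ≤ s) (h' : ∀ p ∈ l', p.2 ≤ t) :
    (hL.mulFiber (hL.expoFiber s l h) (hL.expoFiber t l' h') : Lp ℂ 2 P) =
      hL.expoLp (l ++ translate s l') := by
  refine Lp.ext ?_
  filter_upwards [hL.mulFiber_expoFiber_ae_eq (hL.expoFiber s l h) l' h', hL.expoLp_ae_eq l,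
    hL.expoLp_ae_eq (l ++ translate s l')] with ω h1 h2 h3
  rw [h1, h3, expo_append, expo_translate, ← h2]
  rfl

lemma mulFiber_expoFiber_split (hL : IsLevyProcess L P) {s t : ℝ≥0}
    (l : List (StrongDual ℝ B × ℝ≥0)) (h : ∀ p ∈ l, p.2 ≤ s + t) :
    hL.mulFiber (hL.expoFiber s (beforeTime s l) (beforeTime_le s l))
      (hL.expoFiber t (afterTime s l) (afterTime_le h)) = hL.expoFiber (s + t) l h := by
  refine levyFiber_ext ?_
  filter_upwards [hL.mulFiber_expoFiber_ae_eq (hL.expoFiber s _ (beforeTime_le s l)) _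
    (afterTime_le h), hL.expoLp_ae_eq (beforeTime s l), hL.expoLp_ae_eq l] with ω h1 h2 h3
  rw [h1]
  refine Eq.trans ?_ h3.symm
  rw [expo_split s l, ← h2]
  rfl

/-! ### Continuity of the exponentials -/

lemma inner_expoLp (hL : IsLevyProcess L P) (l l' : List (StrongDual ℝ B × ℝ≥0)) :
    ⟪hL.expoLp l, hL.expoLp l'⟫_ℂ =
      ∫ ω, (starRingEnd ℂ) (expo l fun u => L u ω) * expo l' (fun u => L u ω) ∂P := by
  rw [L2.inner_def]
  refine integral_congr_ae ?_
  filter_upwards [hL.expoLp_ae_eq l, hL.expoLp_ae_eq l'] with ω h1 h2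
  rw [h1, h2, RCLike.inner_apply, mul_comm]

lemma inner_expoLp_self (hL : IsLevyProcess L P) (l : List (StrongDual ℝ B × ℝ≥0)) :
    ⟪hL.expoLp l, hL.expoLp l⟫_ℂ = 1 := by
  rw [inner_expoLp]
  simp [← Complex.normSq_eq_conj_mul_self, Complex.normSq_eq_norm_sq, norm_expo]

lemma norm_expoLp (hL : IsLevyProcess L P) (l : List (StrongDual ℝ B × ℝ≥0)) :
    ‖hL.expoLp l‖ = 1 := by
  have h := hL.inner_expoLp_self l
  rw [inner_self_eq_norm_sq_to_K] at h
  have h' : ‖hL.expoLp l‖ ^ 2 = 1 := Complex.ofReal_injective (by simpa using h)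
  exact (pow_eq_one_iff_of_nonneg (norm_nonneg _) two_ne_zero).1 h'

lemma norm_expoLp_sub_sq (hL : IsLevyProcess L P) (l l' : List (StrongDual ℝ B × ℝ≥0)) :
    ‖hL.expoLp l - hL.expoLp l'‖ ^ 2 = 2 - 2 * (⟪hL.expoLp l, hL.expoLp l'⟫_ℂ).re := by
  rw [norm_sub_sq (𝕜 := ℂ), norm_expoLp, norm_expoLp]
  simp only [RCLike.re_to_complex]
  ring

/-- All factors have modulus one, so the pointwise bound `|ab - a'b'| ≤ |a - a'| + |b - b'|` passes
to `L²` norms. Continuity of products of exponentials thus reduces to single factors. -/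
lemma norm_expoLp_append_sub_le (hL : IsLevyProcess L P)
    (k k' l l' : List (StrongDual ℝ B × ℝ≥0)) :
    ‖hL.expoLp (k ++ l) - hL.expoLp (k' ++ l')‖ ≤
      ‖hL.expoLp k - hL.expoLp k'‖ + ‖hL.expoLp l - hL.expoLp l'‖ := by
  refine (norm_sub_le_norm_sub_add_norm_sub _ (hL.expoLp (k' ++ l)) _).trans (add_le_add ?_ ?_)
  · refine Lp.norm_le_norm_of_ae_le ?_
    filter_upwards [Lp.coeFn_sub (hL.expoLp (k ++ l)) (hL.expoLp (k' ++ l)),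
      Lp.coeFn_sub (hL.expoLp k) (hL.expoLp k'), hL.expoLp_ae_eq (k ++ l),
      hL.expoLp_ae_eq (k' ++ l), hL.expoLp_ae_eq k, hL.expoLp_ae_eq k']
      with ω h1 h2 h3 h4 h5 h6
    rw [h1, h2, Pi.sub_apply, Pi.sub_apply, h3, h4, h5, h6, expo_append, expo_append, ← sub_mul,
      norm_mul, norm_expo, mul_one]
  · refine Lp.norm_le_norm_of_ae_le ?_
    filter_upwards [Lp.coeFn_sub (hL.expoLp (k' ++ l)) (hL.expoLp (k' ++ l')),
      Lp.coeFn_sub (hL.expoLp l) (hL.expoLp l'), hL.expoLp_ae_eq (k' ++ l),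
      hL.expoLp_ae_eq (k' ++ l'), hL.expoLp_ae_eq l, hL.expoLp_ae_eq l']
      with ω h1 h2 h3 h4 h5 h6
    rw [h1, h2, Pi.sub_apply, Pi.sub_apply, h3, h4, h5, h6, expo_append, expo_append,
      ← mul_sub, norm_mul, norm_expo, one_mul]

lemma tendsto_expoLp_append (hL : IsLevyProcess L P) {X : Type*} {F : Filter X}
    {l l' : X → List (StrongDual ℝ B × ℝ≥0)} {l₀ l₀' : List (StrongDual ℝ B × ℝ≥0)}
    (h : Tendsto (fun x => hL.expoLp (l x)) F (𝓝 (hL.expoLp l₀)))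
    (h' : Tendsto (fun x => hL.expoLp (l' x)) F (𝓝 (hL.expoLp l₀'))) :
    Tendsto (fun x => hL.expoLp (l x ++ l' x)) F (𝓝 (hL.expoLp (l₀ ++ l₀'))) := by
  rw [tendsto_iff_norm_sub_tendsto_zero] at h h' ⊢
  exact squeeze_zero (fun _ => norm_nonneg _) (fun x => hL.norm_expoLp_append_sub_le _ _ _ _)
    (by simpa using h.add h')

lemma tendsto_expoLp_map (hL : IsLevyProcess L P) {ι X : Type*} {F : Filter X}
    {q : X → ι → StrongDual ℝ B × ℝ≥0} {q₀ : ι → StrongDual ℝ B × ℝ≥0} (l : List ι)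
    (h : ∀ i ∈ l, Tendsto (fun x => hL.expoLp [q x i]) F (𝓝 (hL.expoLp [q₀ i]))) :
    Tendsto (fun x => hL.expoLp (l.map (q x))) F (𝓝 (hL.expoLp (l.map q₀))) := by
  induction l with
  | nil => exact tendsto_const_nhds
  | cons i l ih =>
    exact hL.tendsto_expoLp_append (l := fun x => [q x i]) (l' := fun x => l.map (q x))
      (l₀ := [q₀ i]) (l₀' := l.map q₀) (h i (by simp)) (ih fun j hj => h j (by simp [hj]))

variable {b : B} {Q : LinearMap.BilinForm ℝ (StrongDual ℝ B)}

lemma levyExponent_smul (a : ℝ) (φ : StrongDual ℝ B) :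
    levyExponent b Q 0 (a • φ) = Complex.I * (a * φ b) - (1 / 2 : ℂ) * (a ^ 2 * Q φ φ) := by
  simp [levyExponent]
  ring

lemma inner_expoLp_same_time (hL : IsLevyProcess L P) (hT : HasTriplet L P b Q 0) (u : ℝ≥0)
    (φ ψ : StrongDual ℝ B) : ⟪hL.expoLp [(φ, u)], hL.expoLp [(ψ, u)]⟫_ℂ =
      Complex.exp (((u : ℝ) : ℂ) * levyExponent b Q 0 (ψ - φ)) := by
  rw [inner_expoLp, ← hT.charFun_eq]
  refine integral_congr_ae (ae_of_all _ fun ω => ?_)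
  simp only [expo_singleton, ← Complex.exp_conj, ← Complex.exp_add, map_mul, Complex.conj_I,
    Complex.conj_ofReal, sub_apply, Complex.ofReal_sub]
  ring_nf

/-- For `u ≤ v` the inner product is the characteristic function of `L_v - L_u`. Exchanging `u` and
`v` conjugates it, so its real part depends on the distance alone. -/
lemma re_inner_expoLp_same_dual (hL : IsLevyProcess L P) (hT : HasTriplet L P b Q 0) (u v : ℝ≥0)
    (φ : StrongDual ℝ B) : (⟪hL.expoLp [(φ, u)], hL.expoLp [(φ, v)]⟫_ℂ).re =
      (Complex.exp (((dist u v : ℝ) : ℂ) * levyExponent b Q 0 φ)).re := by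
  wlog h : u ≤ v generalizing u v
  · rw [dist_comm, ← this v u (le_of_not_ge h)]
    exact inner_re_symm (𝕜 := ℂ) _ _
  obtain ⟨d, rfl⟩ := exists_add_of_le h
  have hd : dist u (u + d) = (d : ℝ) := by
    simp [NNReal.dist_eq]
  rw [inner_expoLp, hd, ← hT.charFun_eq]
  have hm : Measurable fun x : B => Complex.exp (Complex.I * (φ x : ℂ)) :=
    Continuous.measurable (by fun_prop)
  congr 1
  refine Eq.trans ?_ ((hL.stationary u d).comp hm).integral_eq
  refine integral_congr_ae (ae_of_all _ fun ω => ?_)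
  simp only [expo_singleton, ← Complex.exp_conj, ← Complex.exp_add, map_mul, Complex.conj_I,
    Complex.conj_ofReal, map_sub, Complex.ofReal_sub, Function.comp]
  ring_nf

/-- Move the time to `u₀` with the functional fixed, then the coefficient to `a₀` at time `u₀`. For
unit vectors the squared distance is `2 - 2 Re` of the inner product, which the exponent gives
explicitly in both moves. -/
lemma tendsto_expoLp_singleton (hL : IsLevyProcess L P) (hT : HasTriplet L P b Q 0)
    {X : Type*} {F : Filter X} (φ : StrongDual ℝ B) {a : X → ℝ} {a₀ : ℝ} {u : X → ℝ≥0} {u₀ : ℝ≥0}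
    (ha : Tendsto a F (𝓝 a₀)) (hu : Tendsto u F (𝓝 u₀)) :
    Tendsto (fun x => hL.expoLp [(a x • φ, u x)]) F (𝓝 (hL.expoLp [(a₀ • φ, u₀)])) := by
  have h1 : Tendsto (fun x => Real.sqrt (2 - 2 *
      (Complex.exp (((dist (u x) u₀ : ℝ) : ℂ) * levyExponent b Q 0 (a x • φ))).re) +
      Real.sqrt (2 - 2 *
        (Complex.exp (((u₀ : ℝ) : ℂ) * levyExponent b Q 0 ((a₀ - a x) • φ))).re)) F (𝓝 0) := by
    have e1 : Tendsto (fun x => dist (u x) u₀) F (𝓝 0) := tendsto_iff_dist_tendsto_zero.1 hu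
    -- One continuous function of (time, coefficient) covers both distances; it vanishes at the two
    -- limits `(0, a₀)` and `(u₀, 0)`.
    have hc : Continuous fun z : ℝ × ℝ => Real.sqrt (2 - 2 * (Complex.exp ((z.1 : ℂ) *
        (Complex.I * (z.2 * φ b) - (1 / 2 : ℂ) * (z.2 ^ 2 * Q φ φ)))).re) := by fun_prop
    simp only [levyExponent_smul]
    have t1 := (hc.tendsto (0, a₀)).comp (e1.prodMk_nhds ha)
    have t2 := (hc.tendsto ((u₀ : ℝ), a₀ - a₀)).comp
      ((tendsto_const_nhds (x := (u₀ : ℝ))).prodMk_nhds (ha.const_sub a₀))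
    simpa using t1.add t2
  refine tendsto_iff_norm_sub_tendsto_zero.2 (squeeze_zero (fun _ => norm_nonneg _)
    (fun x => ?_) h1)
  refine (norm_sub_le_norm_sub_add_norm_sub _ (hL.expoLp [(a x • φ, u₀)]) _).trans
    (add_le_add ?_ ?_)
  · refine Real.le_sqrt_of_sq_le (le_of_eq ?_)
    rw [norm_expoLp_sub_sq, hL.re_inner_expoLp_same_dual hT]
  · refine Real.le_sqrt_of_sq_le (le_of_eq ?_)
    rw [norm_expoLp_sub_sq, hL.inner_expoLp_same_time hT,
      show (a₀ - a x) • φ = a₀ • φ - a x • φ by ext; simp [sub_mul]]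

lemma continuous_expoLp_map (hL : IsLevyProcess L P) (hT : HasTriplet L P b Q 0)
    {ι X : Type*} [TopologicalSpace X] (l : List ι) (ψ : ι → StrongDual ℝ B) {u : ι → X → ℝ≥0}
    (hu : ∀ i, Continuous (u i)) : Continuous fun x => hL.expoLp (l.map fun i => (ψ i, u i x)) := by
  refine continuous_iff_continuousAt.2 fun x₀ => hL.tendsto_expoLp_map l fun i _ => ?_
  simpa using hL.tendsto_expoLp_singleton hT (ψ i) (tendsto_const_nhds (x := (1 : ℝ)))
    ((hu i).tendsto x₀)

end IsLevyProcess

/-! ### Exponentials are total -/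

section Fourier

variable {Ω ι : Type*} [MeasurableSpace Ω] {P : Measure Ω} [IsFiniteMeasure P]

/-- Replaces the signed density `g` by the finite measures with densities `g⁺` and `g⁻`, to which
uniqueness of characteristic functions applies. -/
lemma integral_withDensity_sub {g : Ω → ℝ} (hg : Integrable g P) (hgm : Measurable g) {h : Ω → ℂ}
    (hh : Measurable h) (hb : ∀ ω, ‖h ω‖ ≤ 1) :
    ∫ ω, h ω ∂(P.withDensity fun ω => ENNReal.ofReal (g ω)) -
      ∫ ω, h ω ∂(P.withDensity fun ω => ENNReal.ofReal (-g ω)) = ∫ ω, h ω * g ω ∂P := by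
  have key : ∀ k : Ω → ℝ, Integrable k P → Measurable k →
      ∫ ω, h ω ∂(P.withDensity fun ω => ENNReal.ofReal (k ω)) = ∫ ω, h ω * (max (k ω) 0 : ℝ) ∂P ∧
      Integrable (fun ω => h ω * (max (k ω) 0 : ℝ)) P := by
    intro k hk hkm
    constructor
    · rw [integral_withDensity_eq_integral_toReal_smul hkm.ennreal_ofReal
        (ae_of_all _ fun _ => ENNReal.ofReal_lt_top)]
      refine integral_congr_ae (ae_of_all _ fun ω => ?_)
      simp only [ENNReal.toReal_ofReal', Complex.real_smul, mul_comm]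
    · exact (hk.pos_part.ofReal (𝕜 := ℂ)).bdd_mul hh.aestronglyMeasurable (ae_of_all _ hb)
  obtain ⟨h1, h1'⟩ := key g hg hgm
  obtain ⟨h2, h2'⟩ := key (fun ω => -g ω) hg.neg hgm.neg
  rw [h1, h2, ← integral_sub h1' h2']
  refine integral_congr_ae (ae_of_all _ fun ω => ?_)
  dsimp only
  rw [← mul_sub, ← Complex.ofReal_sub]
  congr 2
  rcases le_total (g ω) 0 with h | h
  · rw [max_eq_right h, max_eq_left (by linarith)]; ring
  · rw [max_eq_left h, max_eq_right (by linarith)]; ring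

/-- A real function that is orthogonal to the exponentials of finite linear combinations of the
`X_i` integrates to zero over the events of `σ(X_i)`. -/
lemma setIntegral_eq_zero_of_integral_exp_real {X : ι → Ω → ℝ} (hX : ∀ i, Measurable (X i))
    {g : Ω → ℝ} (hg : Integrable g P) (hgm : Measurable g)
    (h0 : ∀ (J : Finset ι) (a : ι → ℝ),
      ∫ ω, Complex.exp (Complex.I * ((∑ i ∈ J, a i * X i ω : ℝ) : ℂ)) * g ω ∂P = 0)
    {A : Set Ω} (hA : MeasurableSet[MeasurableSpace.comap (fun ω i => X i ω) MeasurableSpace.pi] A) :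
    ∫ ω in A, g ω ∂P = 0 := by
  set μ := P.withDensity fun ω => ENNReal.ofReal (g ω) with hμ
  set μ' := P.withDensity fun ω => ENNReal.ofReal (-g ω) with hμ'
  have : IsFiniteMeasure μ := isFiniteMeasure_withDensity_ofReal hg.2
  have : IsFiniteMeasure μ' := isFiniteMeasure_withDensity_ofReal hg.neg.2
  have hXm : Measurable fun ω i => X i ω := measurable_pi_lambda _ hX
  -- By `h0` the finite-dimensional marginals under the two measures have equal characteristic
  -- functions; equal marginals then determine the law of the whole family.
  have hmarg : ∀ J : Finset ι, (μ.map fun ω i => X i ω).map J.restrict =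
      (μ'.map fun ω i => X i ω).map J.restrict := by
    intro J
    have hJ : Measurable (J.restrict ∘ fun ω i => X i ω) :=
      (Finset.measurable_restrict J).comp hXm
    rw [Measure.map_map (Finset.measurable_restrict J) hXm,
      Measure.map_map (Finset.measurable_restrict J) hXm]
    refine Measure.ext_of_charFunDual ?_
    ext ℓ
    rw [charFunDual_apply, charFunDual_apply,
      integral_map hJ.aemeasurable (Continuous.aestronglyMeasurable (by fun_prop)),
      integral_map hJ.aemeasurable (Continuous.aestronglyMeasurable (by fun_prop)), ← sub_eq_zero,
      hμ, hμ', integral_withDensity_sub hg hgm]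
    · classical
      -- The coordinates of `ℓ` in the standard basis, extended by zero off `J`.
      set a : ι → ℝ := fun i => if h : i ∈ J then ℓ (Pi.single ⟨i, h⟩ 1) else 0
      rw [← h0 J a]
      refine integral_congr_ae (ae_of_all _ fun ω => ?_)
      dsimp only
      have : ℓ (J.restrict fun i => X i ω) = ∑ i ∈ J, a i * X i ω := by
        rw [← Finset.sum_coe_sort J]
        conv_lhs => rw [← Finset.univ_sum_single (J.restrict fun i => X i ω)]
        rw [map_sum]
        refine Finset.sum_congr rfl fun i _ => ?_
        have : (Pi.single i (J.restrict (fun i => X i ω) i) : J → ℝ) =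
            X i ω • Pi.single i 1 := by
          rw [← Pi.single_smul]; simp
        rw [this, map_smul, smul_eq_mul, mul_comm]
        simp [a]
      rw [Function.comp_apply, this, mul_comm Complex.I]
    · exact Complex.measurable_exp.comp
        ((Complex.measurable_ofReal.comp (ℓ.continuous.measurable.comp hJ)).mul_const _)
    · intro ω
      exact (Complex.norm_exp_ofReal_mul_I _).le
  have hν : (μ.map fun ω i => X i ω) = μ'.map fun ω i => X i ω :=
    IsProjectiveLimit.unique (P := fun J => (μ'.map fun ω i => X i ω).map J.restrict)
      hmarg (fun _ => rfl)
  obtain ⟨S, hS, rfl⟩ := hA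
  have hS' := hXm hS
  rw [integral_eq_lintegral_pos_part_sub_lintegral_neg_part hg.integrableOn,
    ← withDensity_apply _ hS', ← withDensity_apply _ hS', ← hμ, ← hμ',
    ← Measure.map_apply hXm hS, hν, Measure.map_apply hXm hS, sub_self]

/-- A complex function that is orthogonal to the exponentials of finite linear combinations of the
`X_i` integrates to zero over the events of `σ(X_i)`. -/
lemma setIntegral_eq_zero_of_integral_exp {X : ι → Ω → ℝ} (hX : ∀ i, Measurable (X i))
    {g : Ω → ℂ} (hg : Integrable g P)
    (h0 : ∀ (J : Finset ι) (a : ι → ℝ),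
      ∫ ω, Complex.exp (Complex.I * ((∑ i ∈ J, a i * X i ω : ℝ) : ℂ)) * g ω ∂P = 0)
    {A : Set Ω} (hA : MeasurableSet[MeasurableSpace.comap (fun ω i => X i ω) MeasurableSpace.pi] A) :
    ∫ ω in A, g ω ∂P = 0 := by
  obtain ⟨g', hg'm, hgg'⟩ := hg.1
  wlog hgm : g = g' generalizing g
  · rw [← this (hg.congr hgg') (fun J a => ?_) EventuallyEq.rfl rfl]
    · exact integral_congr_ae (ae_restrict_of_ae hgg')
    · rw [← h0 J a]
      refine integral_congr_ae ?_
      filter_upwards [hgg'] with ω hω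
      rw [hω]
  subst hgm
  have hE : ∀ (J : Finset ι) (a : ι → ℝ), Measurable fun ω =>
      Complex.exp (Complex.I * ((∑ i ∈ J, a i * X i ω : ℝ) : ℂ)) := by
    intro J a; fun_prop
  have hn : ∀ (J : Finset ι) (a : ι → ℝ) ω,
      ‖Complex.exp (Complex.I * ((∑ i ∈ J, a i * X i ω : ℝ) : ℂ))‖ ≤ 1 := by
    intro J a ω
    rw [mul_comm]
    exact (Complex.norm_exp_ofReal_mul_I _).le
  have hi : ∀ (J : Finset ι) (a : ι → ℝ), Integrable (fun ω =>
      Complex.exp (Complex.I * ((∑ i ∈ J, a i * X i ω : ℝ) : ℂ)) * g ω) P := fun J a =>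
    hg.bdd_mul (hE J a).aestronglyMeasurable (ae_of_all _ (hn J a))
  have hgc : Integrable (fun ω => (starRingEnd ℂ) (g ω)) P :=
    hg.congr' (by fun_prop) (by simp)
  have hic : ∀ (J : Finset ι) (a : ι → ℝ), Integrable (fun ω =>
      Complex.exp (Complex.I * ((∑ i ∈ J, a i * X i ω : ℝ) : ℂ)) * (starRingEnd ℂ) (g ω)) P :=
    fun J a => hgc.bdd_mul (hE J a).aestronglyMeasurable (ae_of_all _ (hn J a))
  -- Conjugation turns `a` into `-a`, so the conjugate of `g` satisfies the same hypothesis, and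
  -- with it the real and imaginary parts of `g`.
  have h0c : ∀ (J : Finset ι) (a : ι → ℝ),
      ∫ ω, Complex.exp (Complex.I * ((∑ i ∈ J, a i * X i ω : ℝ) : ℂ)) *
        (starRingEnd ℂ) (g ω) ∂P = 0 := by
    intro J a
    rw [← map_zero (starRingEnd ℂ), ← h0 J (fun i => -a i), ← integral_conj]
    refine integral_congr_ae (ae_of_all _ fun ω => ?_)
    simp [← Complex.exp_conj]
  have hre : ∫ ω in A, (g ω).re ∂P = 0 := by
    refine setIntegral_eq_zero_of_integral_exp_real hX hg.re
      (Complex.measurable_re.comp hg'm.measurable) (fun J a => ?_) hA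
    have := congrArg₂ (· + ·) (h0 J a) (h0c J a)
    rw [← integral_add (hi J a) (hic J a), add_zero] at this
    simp_rw [← mul_add, Complex.add_conj] at this
    have h2 := congrArg (fun z : ℂ => (1 / 2 : ℂ) * z) this
    rw [← integral_const_mul, mul_zero] at h2
    rw [← h2]
    refine integral_congr_ae (ae_of_all _ fun ω => ?_)
    push_cast [RCLike.re_to_complex]
    ring
  have him : ∫ ω in A, (g ω).im ∂P = 0 := by
    refine setIntegral_eq_zero_of_integral_exp_real hX hg.im
      (Complex.measurable_im.comp hg'm.measurable) (fun J a => ?_) hA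
    have := congrArg₂ (· - ·) (h0 J a) (h0c J a)
    rw [← integral_sub (hi J a) (hic J a), sub_zero] at this
    simp_rw [← mul_sub, Complex.sub_conj] at this
    have h2 := congrArg (fun z : ℂ => (1 / (2 * Complex.I) : ℂ) * z) this
    rw [← integral_const_mul, mul_zero] at h2
    rw [← h2]
    refine integral_congr_ae (ae_of_all _ fun ω => ?_)
    push_cast [RCLike.im_to_complex]
    field_simp
  rw [← integral_re_add_im hg.integrableOn]
  simp [hre, him]

end Fourier

/-- A separable Banach space has a sequence of functionals that separates points. -/
lemma exists_separating_seq (B : Type*) [NormedAddCommGroup B] [NormedSpace ℝ B]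
    [SecondCountableTopology B] :
    ∃ φ : ℕ → StrongDual ℝ B, Function.Injective fun (x : B) n => φ n x := by
  -- Norming functionals at the points of a dense sequence. If all of them agree on `x` and `y`,
  -- take `z` in the sequence close to `x - y`: its functional kills `x - y`, so `‖z‖ ≤ ‖z - (x -
  -- y)‖` is small, and so is `‖x - y‖`.
  choose φ hφ hφ' using fun x : B => exists_dual_vector'' ℝ x
  refine ⟨fun n => φ (TopologicalSpace.denseSeq B n), fun x y hxy => ?_⟩
  rw [← sub_eq_zero, ← norm_le_zero_iff]
  refine le_of_forall_pos_le_add fun ε hε => ?_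
  obtain ⟨_, hn, n, rfl⟩ := Metric.dense_iff.1 (TopologicalSpace.denseRange_denseSeq B)
    (x - y) (ε / 2) (by positivity)
  set z := TopologicalSpace.denseSeq B n
  have h0 : φ z (x - y) = 0 := by
    rw [map_sub, sub_eq_zero]; exact congrFun hxy n
  rw [Metric.mem_ball, dist_eq_norm] at hn
  have h1 : ‖z‖ ≤ ‖z - (x - y)‖ := by
    calc ‖z‖ = φ z (z - (x - y)) := by rw [map_sub, h0, hφ' z, sub_zero]; rfl
      _ ≤ ‖φ z (z - (x - y))‖ := Real.le_norm_self _
      _ ≤ 1 * ‖z - (x - y)‖ := (φ z).le_of_opNorm_le (hφ z) _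
      _ = _ := one_mul _
  have h2 : ‖x - y‖ ≤ ‖z‖ + ‖z - (x - y)‖ := by
    have := norm_sub_le z (z - (x - y))
    simpa using this
  linarith

/-- A continuous injection of the Polish space `B` into `ℝ^ℕ` is a measurable embedding
(Lusin–Souslin), so the `φ_n` generate the Borel σ-algebra of `B`. -/
lemma past_le_comap_functionals {Ω B : Type*} [NormedAddCommGroup B]
    [NormedSpace ℝ B] [CompleteSpace B] [SecondCountableTopology B] [MeasurableSpace B]
    [BorelSpace B] (L : ℝ≥0 → Ω → B) (t : ℝ≥0) {φ : ℕ → StrongDual ℝ B}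
    (hφ : Function.Injective fun (x : B) n => φ n x) :
    past L t ≤ MeasurableSpace.comap (fun ω (i : ℕ × Set.Iic t) => φ i.1 (L i.2 ω))
      MeasurableSpace.pi := by
  have he : MeasurableEmbedding fun (x : B) n => φ n x :=
    Continuous.measurableEmbedding (by fun_prop) hφ
  refine iSup_le fun v => ?_
  rw [← he.comap_eq, MeasurableSpace.comap_comp]
  have : (fun (x : B) n => φ n x) ∘ L v = (fun (y : ℕ × Set.Iic t → ℝ) n => y (n, v)) ∘
      fun ω (i : ℕ × Set.Iic t) => φ i.1 (L i.2 ω) := rfl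
  rw [this, ← MeasurableSpace.comap_comp]
  exact MeasurableSpace.comap_mono (by fun_prop : Measurable fun (y : ℕ × Set.Iic t → ℝ) n =>
    y (n, v)).comap_le

/-- The labels of a countable total family of exponentials: `(N, l)` stands for a product of
exponentials of `z / (N + 1) • φ_n` at the times `min k (N + 1) * t / (N + 1)`, where `(n, z, k)`
runs through `l`. -/
abbrev ExpoLabel : Type := ℕ × List (ℕ × ℤ × ℕ)

/-- The list of functionals and times with a given label. -/
noncomputable def labelList {B : Type*} [NormedAddCommGroup B] [NormedSpace ℝ B]
    (φ : ℕ → StrongDual ℝ B) (t : ℝ≥0) (a : ExpoLabel) : List (StrongDual ℝ B × ℝ≥0) :=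
  a.2.map fun i => (((i.2.1 : ℝ) / ((a.1 : ℝ) + 1)) • φ i.1,
    ((min i.2.2 (a.1 + 1) : ℕ) : ℝ≥0) * (t / ((a.1 : ℝ≥0) + 1)))

lemma labelList_le {B : Type*} [NormedAddCommGroup B] [NormedSpace ℝ B]
    (φ : ℕ → StrongDual ℝ B) (t : ℝ≥0) (a : ExpoLabel) : ∀ p ∈ labelList φ t a, p.2 ≤ t := by
  simp only [labelList, List.mem_map]
  rintro _ ⟨i, -, rfl⟩
  have h : ((min i.2.2 (a.1 + 1) : ℕ) : ℝ≥0) ≤ (a.1 : ℝ≥0) + 1 := by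
    exact_mod_cast min_le_right _ _
  calc ((min i.2.2 (a.1 + 1) : ℕ) : ℝ≥0) * (t / ((a.1 : ℝ≥0) + 1))
      ≤ ((a.1 : ℝ≥0) + 1) * (t / ((a.1 : ℝ≥0) + 1)) := mul_le_mul_left h _
    _ = t := mul_div_cancel₀ _ (by positivity)

/-! ### Approximation of coefficients and times by grid points. -/

lemma tendsto_int_floor_mul_div (a : ℝ) :
    Tendsto (fun N : ℕ => (⌊a * ((N : ℝ) + 1)⌋ : ℝ) / ((N : ℝ) + 1)) atTop (𝓝 a) := by
  have h1 : Tendsto (fun N : ℕ => a - 1 / ((N : ℝ) + 1)) atTop (𝓝 a) := by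
    simpa using tendsto_one_div_add_atTop_nhds_zero_nat.const_sub a
  refine tendsto_of_tendsto_of_tendsto_of_le_of_le h1 tendsto_const_nhds (fun N => ?_) fun N => ?_
  · have hN : (0 : ℝ) < (N : ℝ) + 1 := by positivity
    dsimp only
    rw [le_div_iff₀ hN, sub_mul, one_div, inv_mul_cancel₀ hN.ne']
    linarith [Int.lt_floor_add_one (a * ((N : ℝ) + 1))]
  · have hN : (0 : ℝ) < (N : ℝ) + 1 := by positivity
    dsimp only
    rw [div_le_iff₀ hN]
    exact Int.floor_le _

lemma tendsto_grid_time {u t : ℝ≥0} (ht : 0 < t) (h : u ≤ t) :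
    Tendsto (fun N : ℕ => ((min ⌊(u / t : ℝ) * ((N : ℝ) + 1)⌋₊ (N + 1) : ℕ) : ℝ≥0) *
      (t / ((N : ℝ≥0) + 1))) atTop (𝓝 u) := by
  have ht' : (0 : ℝ) < t := ht
  have hut : (u / t : ℝ) ≤ 1 := by rw [div_le_one ht']; exact h
  rw [← NNReal.tendsto_coe]
  have h1 := ((tendsto_nat_floor_mul_div_atTop (R := ℝ) (a := u / t) (by positivity)).comp
    (tendsto_atTop_add_const_right atTop (1 : ℝ) tendsto_natCast_atTop_atTop)).mul_const (t : ℝ)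
  rw [div_mul_cancel₀ _ ht'.ne'] at h1
  refine h1.congr fun N => ?_
  -- The minimum never acts here because `u ≤ t`; it is there so that every label yields times in
  -- `[0, t]`.
  have hm : min ⌊(u / t : ℝ) * ((N : ℝ) + 1)⌋₊ (N + 1) = ⌊(u / t : ℝ) * ((N : ℝ) + 1)⌋₊ := by
    refine min_eq_left (Nat.floor_le_of_le ?_)
    push_cast
    exact mul_le_of_le_one_left (by positivity) hut
  rw [hm]
  simp only [Function.comp]
  push_cast
  ring

namespace IsLevyProcess

variable {Ω : Type u} {B : Type*} [MeasurableSpace Ω] [NormedAddCommGroup B] [NormedSpace ℝ B]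
  [MeasurableSpace B] [SecondCountableTopology B] [BorelSpace B]
  {L : ℝ≥0 → Ω → B} {P : Measure Ω} [IsProbabilityMeasure P]
  {b : B} {Q : LinearMap.BilinForm ℝ (StrongDual ℝ B)}

lemma completeSpace_levyFiber (hL : IsLevyProcess L P) (t : ℝ≥0) :
    CompleteSpace (levyFiber L P t) :=
  haveI : Fact (past L t ≤ ‹MeasurableSpace Ω›) := ⟨hL.past_le t⟩
  inferInstance

/-- The countable family of exponentials in `E(t)`. -/
noncomputable def labelFiber (hL : IsLevyProcess L P) (φ : ℕ → StrongDual ℝ B) (a : ExpoLabel)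
    (t : ℝ≥0) : levyFiber L P t :=
  hL.expoFiber t (labelList φ t a) (labelList_le φ t a)

/-- Round coefficients and times to the grids with denominator `N + 1`; the rounded exponentials
carry labels and converge in `L²`, so orthogonality survives the limit. -/
lemma inner_expoLp_eq_zero_of_label (hL : IsLevyProcess L P) (hT : HasTriplet L P b Q 0)
    {φ : ℕ → StrongDual ℝ B} {t : ℝ≥0} (ht : 0 < t) {g : Lp ℂ 2 P}
    (h0 : ∀ a, ⟪hL.expoLp (labelList φ t a), g⟫_ℂ = 0) (J : List (ℕ × Set.Iic t))
    (c : ℕ × Set.Iic t → ℝ) :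
    ⟪hL.expoLp (J.map fun i => (c i • φ i.1, (i.2 : ℝ≥0))), g⟫_ℂ = 0 := by
  have h1 : Tendsto (fun N : ℕ => hL.expoLp (J.map fun i =>
      (((⌊c i * ((N : ℝ) + 1)⌋ : ℝ) / ((N : ℝ) + 1)) • φ i.1,
        ((min ⌊((i.2 : ℝ≥0) / t : ℝ) * ((N : ℝ) + 1)⌋₊ (N + 1) : ℕ) : ℝ≥0) *
          (t / ((N : ℝ≥0) + 1))))) atTop
      (𝓝 (hL.expoLp (J.map fun i => (c i • φ i.1, (i.2 : ℝ≥0))))) :=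
    hL.tendsto_expoLp_map J fun i _ => hL.tendsto_expoLp_singleton hT (φ i.1)
      (tendsto_int_floor_mul_div (c i)) (tendsto_grid_time ht i.2.2)
  refine tendsto_nhds_unique (h1.inner tendsto_const_nhds) ?_
  refine tendsto_const_nhds.congr fun N => ?_
  rw [← h0 (N, J.map fun i => (i.1, ⌊c i * ((N : ℝ) + 1)⌋,
    ⌊((i.2 : ℝ≥0) / t : ℝ) * ((N : ℝ) + 1)⌋₊))]
  simp only [labelList, List.map_map]
  rfl

/-- The exponentials with labels are total in `E(t)`. -/
theorem topologicalClosure_span_labelFiber [CompleteSpace B] (hL : IsLevyProcess L P)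
    (hT : HasTriplet L P b Q 0)
    {φ : ℕ → StrongDual ℝ B} (hφ : Function.Injective fun (x : B) n => φ n x)
    {t : ℝ≥0} (ht : 0 < t) :
    (Submodule.span ℂ (Set.range fun a => hL.labelFiber φ a t)).topologicalClosure = ⊤ := by
  have := hL.completeSpace_levyFiber t
  rw [Submodule.topologicalClosure_eq_top_iff, Submodule.eq_bot_iff]
  intro g hg
  have h0 : ∀ a, ⟪hL.expoLp (labelList φ t a), (g : Lp ℂ 2 P)⟫_ℂ = 0 := fun a =>
    (Submodule.mem_orthogonal _ _).1 hg _ (Submodule.subset_span ⟨a, rfl⟩)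
  have hgi : Integrable (g : Lp ℂ 2 P) P := (Lp.memLp (g : Lp ℂ 2 P)).integrable (by norm_num)
  have h1 : ∀ A, MeasurableSet[past L t] A → ∫ ω in A, (g : Lp ℂ 2 P) ω ∂P = 0 := by
    intro A hA
    refine setIntegral_eq_zero_of_integral_exp
      (X := fun (i : ℕ × Set.Iic t) ω => φ i.1 (L i.2 ω))
      (fun i => (φ i.1).continuous.measurable.comp (hL.measurable _)) hgi (fun J c => ?_)
      (past_le_comap_functionals L t hφ A hA)
    -- The sign compensates for the conjugation in the first slot of the inner product.
    rw [← hL.inner_expoLp_eq_zero_of_label hT ht h0 J.toList (fun i => -c i), L2.inner_def]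
    refine integral_congr_ae ?_
    filter_upwards [hL.expoLp_ae_eq (J.toList.map fun i => ((-c i) • φ i.1, (i.2 : ℝ≥0)))]
      with ω hω
    rw [hω, RCLike.inner_apply, mul_comm, expo, ← Complex.exp_conj]
    simp only [List.map_map, Function.comp_def, Finset.sum_map_toList, map_mul, Complex.conj_I,
      Complex.conj_ofReal]
    simp
  refine Subtype.ext (Lp.ext ?_)
  refine (lpMeas.ae_eq_zero_of_forall_setIntegral_eq_zero (hL.past_le t) g two_ne_zero
    ENNReal.ofNat_ne_top (fun s _ _ => hgi.integrableOn) fun s hs _ => h1 s hs).trans ?_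
  exact (Lp.coeFn_zero ℂ 2 P).symm

/-! ### Units -/

lemma expoFiber_congr (hL : IsLevyProcess L P) {t : ℝ≥0} {l l' : List (StrongDual ℝ B × ℝ≥0)}
    (h : ∀ p ∈ l, p.2 ≤ t) (h' : ∀ p ∈ l', p.2 ≤ t)
    (hl : ∀ x : ℝ≥0 → B, x 0 = 0 → expo l x = expo l' x) :
    hL.expoFiber t l h = hL.expoFiber t l' h' := by
  refine levyFiber_ext ?_
  filter_upwards [hL.expoLp_ae_eq l, hL.expoLp_ae_eq l', hL.zero] with ω h1 h2 h3
  refine h1.trans (Eq.trans ?_ h2.symm)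
  exact hl _ h3

/-- The unit `t ↦ exp (i φ(L_t))`. -/
noncomputable def expUnit (hL : IsLevyProcess L P) (φ : StrongDual ℝ B) (t : PosTime) :
    levyFiber L P t :=
  hL.expoFiber t [(φ, (t : ℝ≥0))] (by simp)

/-- Multiplicativity is `φ(L_{s+t}) = φ(L_s) + φ(L_{s+t} - L_s)` under the exponential; the section
is Borel because it is continuous into `L²`. -/
lemma isUnitSection_expUnit (hL : IsLevyProcess L P) (hT : HasTriplet L P b Q 0)
    (φ : StrongDual ℝ B) : hL.productSystem.IsUnitSection (hL.expUnit φ) where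
  measurable := by
    let : MeasurableSpace (Lp ℂ 2 P) := borel _
    have : BorelSpace (Lp ℂ 2 P) := ⟨rfl⟩
    have h : Continuous fun t : PosTime => hL.expoLp [(φ, (t : ℝ≥0))] :=
      hL.continuous_expoLp_map hT [()] (fun _ => φ) (u := fun _ (t : PosTime) => (t : ℝ≥0))
        fun _ => continuous_subtype_val
    exact measurable_comap_iff.2 (measurable_id.prodMk h.measurable)
  ne_zero := by
    refine ⟨⟨1, one_pos⟩, fun h => ?_⟩
    have h1 := hL.norm_expoLp [(φ, (1 : ℝ≥0))]
    have h2 : hL.expoLp [(φ, (1 : ℝ≥0))] = 0 := congrArg Subtype.val h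
    simp [h2] at h1
  map_add s t := by
    refine Subtype.ext (Eq.trans ?_ (hL.mulFiber_expoFiber _ _ _ _).symm)
    refine Lp.ext ?_
    filter_upwards [hL.expoLp_ae_eq [(φ, (s + t : ℝ≥0))],
      hL.expoLp_ae_eq ([(φ, (s : ℝ≥0))] ++ translate s [(φ, (t : ℝ≥0))])] with ω h1 h2
    refine h1.trans (Eq.trans ?_ h2.symm)
    rw [expo_append, expo_translate]
    simp only [expo_singleton, ← Complex.exp_add, ← mul_add]
    simp

/-- Terms at time `0` contribute nothing, and the functionals at time `t` add up. This is how a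
single grid step becomes the value of one unit. -/
lemma exists_expo_eq_singleton {t : ℝ≥0} (l : List (StrongDual ℝ B × ℝ≥0))
    (h : ∀ p ∈ l, p.2 = 0 ∨ p.2 = t) :
    ∃ ψ : StrongDual ℝ B, ∀ x : ℝ≥0 → B, x 0 = 0 → expo l x = expo [(ψ, t)] x := by
  induction l with
  | nil => exact ⟨0, fun x _ => by simp [expo_singleton]⟩
  | cons p l ih =>
    obtain ⟨ψ, hψ⟩ := ih fun q hq => h q (by simp [hq])
    rcases h p (by simp) with hp | hp
    · refine ⟨ψ, fun x hx => ?_⟩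
      rw [expo_cons, hψ x hx]
      simp [expo_singleton, hp, hx]
    · refine ⟨p.1 + ψ, fun x hx => ?_⟩
      rw [expo_cons, hψ x hx]
      simp [expo_singleton, hp, ← Complex.exp_add, mul_add]

lemma exists_expoFiber_eq_expUnit (hL : IsLevyProcess L P) {t : PosTime}
    (l : List (StrongDual ℝ B × ℝ≥0)) (hle : ∀ p ∈ l, p.2 ≤ t)
    (h : ∀ p ∈ l, p.2 = 0 ∨ p.2 = t) :
    ∃ ψ, hL.expoFiber t l hle = hL.expUnit ψ t := by
  obtain ⟨ψ, hψ⟩ := exists_expo_eq_singleton l h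
  exact ⟨ψ, hL.expoFiber_congr _ _ hψ⟩

/-- Exponentials with times on a uniform grid are products of units. -/
lemma unitProduct_expoFiber (hL : IsLevyProcess L P) (hT : HasTriplet L P b Q 0) {h : ℝ≥0}
    (hh : 0 < h) (N : ℕ) (t : PosTime) (ht : (t : ℝ≥0) = ((N : ℝ≥0) + 1) * h)
    (l : List (StrongDual ℝ B × ℝ≥0)) (hle : ∀ p ∈ l, p.2 ≤ t)
    (hl : ∀ p ∈ l, ∃ k : ℕ, p.2 = k * h) :
    hL.productSystem.UnitProduct t (hL.expoFiber t l hle) := by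
  induction N generalizing t l with
  | zero =>
    have h1 : ∀ p ∈ l, p.2 = 0 ∨ p.2 = t := by
      intro p hp
      obtain ⟨k, hk⟩ := hl p hp
      rcases Nat.eq_zero_or_pos k with rfl | hk0
      · left; simpa using hk
      · right
        refine le_antisymm (hle p hp) ?_
        rw [ht, hk]
        simpa using mul_le_mul_left (Nat.one_le_cast.2 hk0 : (1 : ℝ≥0) ≤ k) h
    obtain ⟨ψ, hψ⟩ := hL.exists_expoFiber_eq_expUnit l hle h1
    rw [hψ]
    exact .single _ (hL.isUnitSection_expUnit hT ψ) t
  | succ N ih =>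
    set s : PosTime := ⟨h, hh⟩
    set r : PosTime := ⟨((N : ℝ≥0) + 1) * h, by positivity⟩
    obtain rfl : t = s + r := by
      refine Subtype.ext (ht.trans ?_)
      change _ = h + ((N : ℝ≥0) + 1) * h
      push_cast
      ring
    -- Grid times cut off at the first step `h` are `0` or `h`, so the first factor is the value of
    -- a unit.
    have h1 : ∀ p ∈ beforeTime (s : ℝ≥0) l, p.2 = 0 ∨ p.2 = s := by
      simp only [beforeTime, List.mem_map]
      rintro _ ⟨p, hp, rfl⟩
      obtain ⟨k, hk⟩ := hl p hp
      rcases Nat.eq_zero_or_pos k with rfl | hk0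
      · left; simp [hk]
      · right
        refine min_eq_right ?_
        rw [hk]
        simpa using mul_le_mul_left (Nat.one_le_cast.2 hk0 : (1 : ℝ≥0) ≤ k) h
    obtain ⟨ψ, hψ⟩ := hL.exists_expoFiber_eq_expUnit _ (beforeTime_le (s : ℝ≥0) l) h1
    have h2 := ih r rfl (afterTime (s : ℝ≥0) l) (afterTime_le hle) (by
      simp only [afterTime, List.mem_map]
      rintro _ ⟨p, hp, rfl⟩
      obtain ⟨k, hk⟩ := hl p hp
      -- Both subtractions are truncated, so `k = 0` needs no exception: both sides are zero.
      refine ⟨k - 1, ?_⟩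
      change p.2 - h = _
      rw [hk]
      rcases Nat.eq_zero_or_pos k with rfl | hk0
      · simp
      · obtain ⟨j, rfl⟩ := Nat.exists_eq_succ_of_ne_zero hk0.ne'
        simp [add_mul])
    have h3 := hL.mulFiber_expoFiber_split (s := s) (t := r) l hle
    rw [hψ] at h3
    change hL.productSystem.UnitProduct (s + r) (hL.expoFiber ((s : ℝ≥0) + r) l hle)
    rw [← h3]
    exact .cons _ (hL.isUnitSection_expUnit hT ψ) s r _ h2

lemma unitProduct_labelFiber (hL : IsLevyProcess L P) (hT : HasTriplet L P b Q 0)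
    (φ : ℕ → StrongDual ℝ B) (a : ExpoLabel) (t : PosTime) :
    hL.productSystem.UnitProduct t (hL.labelFiber φ a t) := by
  refine hL.unitProduct_expoFiber hT (h := (t : ℝ≥0) / ((a.1 : ℝ≥0) + 1))
    (div_pos t.2 (by positivity)) a.1 t (mul_div_cancel₀ _ (by positivity)).symm _ _ ?_
  simp only [labelList, List.mem_map]
  rintro _ ⟨i, -, rfl⟩
  exact ⟨_, rfl⟩

theorem isCompletelySpatial_productSystem [CompleteSpace B] (hL : IsLevyProcess L P)
    (hT : HasTriplet L P b Q 0) : hL.productSystem.IsCompletelySpatial := by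
  -- The functional `0` gives the constant unit `1`.
  refine ⟨⟨_, hL.isUnitSection_expUnit hT 0⟩, fun t => ?_⟩
  obtain ⟨φ, hφ⟩ := exists_separating_seq B
  refine top_le_iff.1 ((hL.topologicalClosure_span_labelFiber hT hφ t.2).ge.trans ?_)
  refine Submodule.topologicalClosure_mono (Submodule.span_mono ?_)
  rintro _ ⟨a, rfl⟩
  exact hL.unitProduct_labelFiber hT φ a t

/-! ### The fibres are infinite-dimensional -/

/-- If `Q` vanished on the diagonal, polarization would give `Q = 0`; non-degeneracy would then kill
the dual, against Hahn–Banach. -/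
lemma exists_pos_of_nondegenerate [Nontrivial B] (hQ : Q.Nondegenerate)
    (hT : HasTriplet L P b Q 0) : ∃ φ, 0 < Q φ φ := by
  by_contra! h
  have h0 : ∀ φ, Q φ φ = 0 := fun φ => le_antisymm (h φ) (hT.nonneg φ)
  have h1 : ∀ φ ψ, Q φ ψ = 0 := fun φ ψ => by
    have := h0 (φ + ψ)
    simp only [map_add, LinearMap.add_apply, h0, hT.symm ψ φ] at this
    linarith
  obtain ⟨x, hx⟩ := exists_ne (0 : B)
  obtain ⟨φ, hφ⟩ := SeparatingDual.exists_ne_zero (R := ℝ) hx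
  refine hφ ?_
  rw [hQ.1 φ (h1 φ)]
  rfl

/-- The vectors `exp (i k φ(L_t))`, `k ∈ ℕ`, lie on the unit sphere and stay uniformly apart: for `j
≠ k` their inner product has modulus `exp (-t (k - j)² Q(φ,φ) / 2) ≤ c < 1`. A finite-dimensional
ball would yield a convergent subsequence. -/
lemma not_finiteDimensional_levyFiber (hL : IsLevyProcess L P) (hT : HasTriplet L P b Q 0)
    {φ : StrongDual ℝ B} (hφ : 0 < Q φ φ) {t : ℝ≥0} (ht : 0 < t) :
    ¬ FiniteDimensional ℂ (levyFiber L P t) := by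
  intro hfin
  have := FiniteDimensional.proper ℂ (levyFiber L P t)
  set e : ℕ → levyFiber L P t := fun k => hL.expoFiber t [((k : ℝ) • φ, t)] (by simp)
  have ht' : (0 : ℝ) < t := ht
  set c : ℝ := Real.exp (-(t * Q φ φ / 2)) with hc
  have hc1 : c < 1 := by
    rw [hc, ← Real.exp_zero, Real.exp_lt_exp]
    have := mul_pos ht' hφ
    linarith
  have hsep : ∀ j k, j ≠ k → 2 - 2 * c ≤ dist (e j) (e k) ^ 2 := by
    intro j k hjk
    have h1 : dist (e j) (e k) =
        ‖hL.expoLp [((j : ℝ) • φ, t)] - hL.expoLp [((k : ℝ) • φ, t)]‖ := dist_eq_norm _ _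
    rw [h1, norm_expoLp_sub_sq, hL.inner_expoLp_same_time hT,
      show (k : ℝ) • φ - (j : ℝ) • φ = ((k : ℝ) - j) • φ by ext; simp [sub_mul],
      levyExponent_smul]
    have h2 : (1 : ℝ) ≤ ((k : ℝ) - j) ^ 2 := by
      have : (1 : ℤ) ≤ ((k : ℤ) - j) ^ 2 := by
        have : ((k : ℤ) - j) ≠ 0 := by omega
        have := sq_nonneg ((k : ℤ) - j)
        have := pow_pos (abs_pos.2 ‹((k : ℤ) - j) ≠ 0›) 2
        rw [sq_abs] at this
        omega
      exact_mod_cast this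
    have h3 : (Complex.exp (((t : ℝ) : ℂ) * (Complex.I * ((((k : ℝ) - j : ℝ) : ℂ) * φ b) -
        (1 / 2 : ℂ) * ((((k : ℝ) - j : ℝ) : ℂ) ^ 2 * Q φ φ)))).re ≤ c := by
      refine (Complex.re_le_norm _).trans ?_
      rw [Complex.norm_exp, hc, Real.exp_le_exp]
      have : (((t : ℝ) : ℂ) * (Complex.I * ((((k : ℝ) - j : ℝ) : ℂ) * φ b) -
          (1 / 2 : ℂ) * ((((k : ℝ) - j : ℝ) : ℂ) ^ 2 * Q φ φ))) =
          ((-(t * (((k : ℝ) - j) ^ 2 * Q φ φ) / 2) : ℝ) : ℂ) +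
            ((t * (((k : ℝ) - j) * φ b) : ℝ) : ℂ) * Complex.I := by
        push_cast; ring
      rw [this, Complex.add_re, Complex.ofReal_re, Complex.re_ofReal_mul, Complex.I_re, mul_zero,
        add_zero, neg_le_neg_iff]
      have : Q φ φ ≤ ((k : ℝ) - j) ^ 2 * Q φ φ := le_mul_of_one_le_left hφ.le h2
      have := mul_le_mul_of_nonneg_left this ht'.le
      linarith
    linarith
  have hb : ∀ k, e k ∈ Metric.closedBall (0 : levyFiber L P t) 1 := fun k => by
    rw [mem_closedBall_zero_iff]
    exact (hL.norm_expoLp _).le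
  obtain ⟨x, -, f, hf, hx⟩ := tendsto_subseq_of_bounded Metric.isBounded_closedBall hb
  have h1 := (hx.dist (hx.comp (tendsto_add_atTop_nat 1))).pow 2
  rw [dist_self] at h1
  have h2 : 2 - 2 * c ≤ 0 ^ 2 := ge_of_tendsto' h1 fun n => hsep _ _ (hf (Nat.lt_succ_self n)).ne
  linarith

/-! ### Measurability of the multiplication -/

lemma continuous_labelFiber (hL : IsLevyProcess L P) (hT : HasTriplet L P b Q 0)
    (φ : ℕ → StrongDual ℝ B) (a : ExpoLabel) :
    Continuous fun t : PosTime => (hL.labelFiber φ a t : Lp ℂ 2 P) :=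
  hL.continuous_expoLp_map hT a.2 (fun i => ((i.2.1 : ℝ) / ((a.1 : ℝ) + 1)) • φ i.1)
    (u := fun i (t : PosTime) => ((min i.2.2 (a.1 + 1) : ℕ) : ℝ≥0) * (t / ((a.1 : ℝ≥0) + 1)))
    fun i => by fun_prop

lemma continuous_mulFiber_labelFiber (hL : IsLevyProcess L P) (hT : HasTriplet L P b Q 0)
    (φ : ℕ → StrongDual ℝ B) (a a' : ExpoLabel) : Continuous fun z : PosTime × PosTime =>
      (hL.mulFiber (hL.labelFiber φ a z.1) (hL.labelFiber φ a' z.2) : Lp ℂ 2 P) := by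
  have h : ∀ z : PosTime × PosTime,
      (hL.mulFiber (hL.labelFiber φ a z.1) (hL.labelFiber φ a' z.2) : Lp ℂ 2 P) =
        hL.expoLp (labelList φ z.1 a ++ translate z.1 (labelList φ z.2 a')) := fun z =>
    hL.mulFiber_expoFiber _ _ _ _
  simp_rw [h]
  have h1 : Continuous fun z : PosTime × PosTime => hL.expoLp (labelList φ z.1 a) :=
    (hL.continuous_labelFiber hT φ a).comp continuous_fst
  have h2 : Continuous fun z : PosTime × PosTime =>
      hL.expoLp ((labelList φ z.2 a').map fun p => (p.1, (z.1 : ℝ≥0) + p.2)) := by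
    simp only [labelList, List.map_map]
    exact hL.continuous_expoLp_map hT a'.2 (fun i => ((i.2.1 : ℝ) / ((a'.1 : ℝ) + 1)) • φ i.1)
      (u := fun i (z : PosTime × PosTime) => (z.1 : ℝ≥0) +
        ((min i.2.2 (a'.1 + 1) : ℕ) : ℝ≥0) * (z.2 / ((a'.1 : ℝ≥0) + 1)))
      fun i => by fun_prop
  have h3 : Continuous fun z : PosTime × PosTime =>
      hL.expoLp ((labelList φ z.2 a').map fun p => (-p.1, (z.1 : ℝ≥0))) := by
    simp only [labelList, List.map_map]
    exact hL.continuous_expoLp_map hT a'.2 (fun i => -(((i.2.1 : ℝ) / ((a'.1 : ℝ) + 1)) • φ i.1))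
      (u := fun i (z : PosTime × PosTime) => (z.1 : ℝ≥0)) fun i => by fun_prop
  exact continuous_iff_continuousAt.2 fun z => hL.tendsto_expoLp_append (h1.tendsto z)
    (hL.tendsto_expoLp_append (h2.tendsto z) (h3.tendsto z))

/-- With one factor fixed, joint measurability of the product is a module condition on the other, so
it passes from the labelled exponentials to the basis sections. -/
lemma isSectionModule_mulFiber_left (hL : IsLevyProcess L P) (x : ∀ t : PosTime, levyFiber L P t) :
    IsSectionModule {y : ∀ t : PosTime, levyFiber L P t | StronglyMeasurable
      fun z : PosTime × PosTime => (hL.mulFiber (x z.1) (y z.2) : Lp ℂ 2 P)} where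
  add y hy y' hy' := by
    simp only [Set.mem_ofPred_eq, mulFiber_add] at *
    exact hy.add hy'
  smul c hc y hy := by
    simp only [Set.mem_ofPred_eq, mulFiber_smul] at *
    exact StronglyMeasurable.smul (hc.comp measurable_snd).stronglyMeasurable hy
  glue N hN y hy := stronglyMeasurable_glue (F := fun n (z : PosTime × PosTime) =>
    (hL.mulFiber (x z.1) (y n z.2) : Lp ℂ 2 P)) (hN.comp measurable_snd) hy

lemma isSectionModule_mulFiber_right (hL : IsLevyProcess L P)
    (y : ∀ t : PosTime, levyFiber L P t) :
    IsSectionModule {x : ∀ t : PosTime, levyFiber L P t | StronglyMeasurable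
      fun z : PosTime × PosTime => (hL.mulFiber (x z.1) (y z.2) : Lp ℂ 2 P)} where
  add x hx x' hx' := by
    simp only [Set.mem_ofPred_eq, add_mulFiber] at *
    exact hx.add hx'
  smul c hc x hx := by
    simp only [Set.mem_ofPred_eq, smul_mulFiber] at *
    exact StronglyMeasurable.smul (hc.comp measurable_fst).stronglyMeasurable hx
  glue N hN x hx := stronglyMeasurable_glue (F := fun n (z : PosTime × PosTime) =>
    (hL.mulFiber (x n z.1) (y z.2) : Lp ℂ 2 P)) (hN.comp measurable_fst) hx

/-- There are orthonormal bases of the fibres that are measurable sections and whose products are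
measurable. -/
lemma exists_measurable_basis [CompleteSpace B] [Nontrivial B] (hL : IsLevyProcess L P)
    (hQ : Q.Nondegenerate) (hT : HasTriplet L P b Q 0) :
    ∃ e : ∀ t : PosTime, HilbertBasis ℕ ℂ (levyFiber L P t),
      (∀ n, StronglyMeasurable fun t : PosTime => (e t n : Lp ℂ 2 P)) ∧
      ∀ m n, StronglyMeasurable fun z : PosTime × PosTime =>
        (hL.mulFiber (e z.1 m) (e z.2 n) : Lp ℂ 2 P) := by
  obtain ⟨φ, hφ⟩ := exists_separating_seq B
  obtain ⟨ψ, hψ⟩ := exists_pos_of_nondegenerate hQ hT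
  obtain ⟨a, ha⟩ := exists_surjective_nat ExpoLabel
  have := fun t : PosTime => hL.completeSpace_levyFiber t
  have hd : ∀ n, StronglyMeasurable fun t : PosTime => (hL.labelFiber φ (a n) t : Lp ℂ 2 P) :=
    fun n => (hL.continuous_labelFiber hT φ (a n)).stronglyMeasurable
  obtain ⟨e, he⟩ := exists_measurable_hilbertBasis (T := PosTime) (H := Lp ℂ 2 P)
    (K := fun t : PosTime => levyFiber L P t) (d := fun n t => hL.labelFiber φ (a n) t) hd
    (fun t => by
      rw [← hL.topologicalClosure_span_labelFiber hT hφ t.2,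
        ← ha.range_comp fun c => hL.labelFiber φ c t]
      rfl)
    fun t => hL.not_finiteDimensional_levyFiber hT hψ t.2
  -- Labelled exponentials are exchanged for basis sections one factor at a time: the right factor
  -- here, the left one below.
  have h1 : ∀ i n, StronglyMeasurable fun z : PosTime × PosTime =>
      (hL.mulFiber (hL.labelFiber φ (a i) z.1) (e z.2 n) : Lp ℂ 2 P) := fun i =>
    he _ (hL.isSectionModule_mulFiber_left fun t => hL.labelFiber φ (a i) t) fun j =>
      (hL.continuous_mulFiber_labelFiber hT φ (a i) (a j)).stronglyMeasurable
  exact ⟨e, he _ isSectionModule_stronglyMeasurable hd, fun m n =>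
    he _ (hL.isSectionModule_mulFiber_right fun t => e t n) (fun i => h1 i n) m⟩

/-- Each labelled exponential on `[0, s + t]` is itself a product, split at time `s`. -/
lemma dense_mulFiber [CompleteSpace B] (hL : IsLevyProcess L P) (hT : HasTriplet L P b Q 0)
    {s t : ℝ≥0} (hs : 0 < s) :
    (Submodule.span ℂ (Set.range fun p : levyFiber L P s × levyFiber L P t =>
      hL.mulFiber p.1 p.2)).topologicalClosure = ⊤ := by
  obtain ⟨φ, hφ⟩ := exists_separating_seq B
  have h := hL.topologicalClosure_span_labelFiber hT hφ (t := s + t) (by positivity)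
  refine top_le_iff.1 (h.ge.trans ?_)
  refine Submodule.topologicalClosure_mono (Submodule.span_mono ?_)
  rintro _ ⟨a, rfl⟩
  exact ⟨(_, _), hL.mulFiber_expoFiber_split (labelList φ (s + t) a) (labelList_le φ (s + t) a)⟩

/-- Associativity compares fibres over times that are equal but not identical; inside the common
space `L²` no transport is needed. -/
lemma total_ext (hL : IsLevyProcess L P) {s t : PosTime} {f : levyFiber L P s}
    {g : levyFiber L P t} (h : s = t) (h' : (f : Lp ℂ 2 P) = g) :
    (⟨s, f⟩ : hL.productSystem.Total) = ⟨t, g⟩ := by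
  subst h
  exact congrArg _ (Subtype.ext h')

lemma bilin_sum_smul {X Y Z ι : Type*} [AddCommGroup X] [AddCommGroup Y] [AddCommGroup Z]
    [Module ℂ X] [Module ℂ Y] [Module ℂ Z] (m : X →ₗ[ℂ] Y →ₗ[ℂ] Z) (I : Finset ι) (c c' : ι → ℂ)
    (f : ι → X) (g : ι → Y) : m (∑ i ∈ I, c i • f i) (∑ j ∈ I, c' j • g j) =
      ∑ i ∈ I, ∑ j ∈ I, (c i * c' j) • m (f i) (g j) := by
  simp only [map_sum, map_smul, LinearMap.sum_apply, LinearMap.smul_apply, Finset.smul_sum, smul_smul]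
  rw [Finset.sum_comm]
  simp only [mul_comm]

lemma mulFiber_sum (hL : IsLevyProcess L P) {s t : ℝ≥0} {ι : Type*} (I : Finset ι) (c c' : ι → ℂ)
    (f : ι → levyFiber L P s) (g : ι → levyFiber L P t) :
    hL.mulFiber (∑ i ∈ I, c i • f i) (∑ j ∈ I, c' j • g j) =
      ∑ i ∈ I, ∑ j ∈ I, (c i * c' j) • hL.mulFiber (f i) (g j) :=
  bilin_sum_smul (LinearMap.mk₂ ℂ hL.mulFiber hL.add_mulFiber hL.smul_mulFiber
    hL.mulFiber_add hL.mulFiber_smul) I c c' f g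

/-- Expand both factors in the measurable bases. The double partial sums are strongly measurable and
converge by continuity of the bilinear map `mulCLM`. -/
lemma measurable_mulFiber [MeasurableSpace (Lp ℂ 2 P)] [BorelSpace (Lp ℂ 2 P)]
    (hL : IsLevyProcess L P) {e : ∀ t : PosTime, HilbertBasis ℕ ℂ (levyFiber L P t)}
    (he : ∀ n, StronglyMeasurable fun t : PosTime => (e t n : Lp ℂ 2 P))
    (hee : ∀ m n, StronglyMeasurable fun z : PosTime × PosTime =>
        (hL.mulFiber (e z.1 m) (e z.2 n) : Lp ℂ 2 P))
    {m : MeasurableSpace (Σ t : PosTime, levyFiber L P t)}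
    (hm : Measurable fun p : Σ t : PosTime, levyFiber L P t => (p.1, (p.2 : Lp ℂ 2 P))) :
    Measurable fun p : (Σ t : PosTime, levyFiber L P t) × (Σ t : PosTime, levyFiber L P t) =>
      (hL.mulFiber p.1.2 p.2.2 : Lp ℂ 2 P) := by
  have hc : ∀ n, Measurable fun p : Σ t : PosTime, levyFiber L P t =>
      ⟪(e p.1 n : Lp ℂ 2 P), (p.2 : Lp ℂ 2 P)⟫_ℂ := fun n =>
    measurable_inner_section (K := fun t : PosTime => levyFiber L P t) (v := fun t => e t n)
      (he n) hm
  have hfst : Measurable fun p : Σ t : PosTime, levyFiber L P t => p.1 := measurable_fst.comp hm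
  refine StronglyMeasurable.measurable (stronglyMeasurable_of_tendsto atTop
    (f := fun N (p : (Σ t : PosTime, levyFiber L P t) × (Σ t : PosTime, levyFiber L P t)) =>
      ∑ i ∈ Finset.range N, ∑ j ∈ Finset.range N,
        (⟪(e p.1.1 i : Lp ℂ 2 P), (p.1.2 : Lp ℂ 2 P)⟫_ℂ *
          ⟪(e p.2.1 j : Lp ℂ 2 P), (p.2.2 : Lp ℂ 2 P)⟫_ℂ) •
            (hL.mulFiber (e p.1.1 i) (e p.2.1 j) : Lp ℂ 2 P)) (fun N => ?_) ?_)
  · refine Finset.stronglyMeasurable_fun_sum _ fun i _ =>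
      Finset.stronglyMeasurable_fun_sum _ fun j _ => ?_
    have h1 := (((hc i).comp measurable_fst).mul ((hc j).comp measurable_snd)).stronglyMeasurable
    have h2 := (hee i j).comp_measurable
      ((hfst.comp measurable_fst).prodMk (hfst.comp measurable_snd))
    exact h1.smul h2
  · rw [tendsto_pi_nhds]
    rintro ⟨⟨s, f⟩, ⟨t, g⟩⟩
    have hf := ((e s).hasSum_repr f).tendsto_sum_nat
    have hg := ((e t).hasSum_repr g).tendsto_sum_nat
    have h := (continuous_subtype_val.tendsto _).comp
      (((hL.mulCLM s t).continuous₂.tendsto (f, g)).comp (hf.prodMk_nhds hg))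
    refine h.congr fun N => ?_
    have h2 := hL.mulFiber_sum (Finset.range N) (fun i => (e s).repr f i)
      (fun j => (e t).repr g j) (e s) (e t)
    refine (congrArg Subtype.val h2).trans ?_
    rw [AddSubmonoidClass.coe_finsetSum]
    refine Finset.sum_congr rfl fun i _ => ?_
    rw [AddSubmonoidClass.coe_finsetSum]
    refine Finset.sum_congr rfl fun j _ => ?_
    rw [HilbertBasis.repr_apply_apply, HilbertBasis.repr_apply_apply]
    rfl

/-! ### The product system laws. -/

theorem isProductSystem_productSystem [CompleteSpace B] [Nontrivial B] (hL : IsLevyProcess L P)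
    (hQ : Q.Nondegenerate) (hT : HasTriplet L P b Q 0) : hL.productSystem.IsProductSystem := by
  let : MeasurableSpace (Lp ℂ 2 P) := borel _
  have : BorelSpace (Lp ℂ 2 P) := ⟨rfl⟩
  let : MeasurableSpace HilbertBundle.EllTwo := borel _
  have : BorelSpace HilbertBundle.EllTwo := ⟨rfl⟩
  obtain ⟨e, he, hee⟩ := hL.exists_measurable_basis hQ hT
  have hm : Measurable[hL.productSystem.borelStructure]
      fun p : Σ t : PosTime, levyFiber L P t => (p.1, (p.2 : Lp ℂ 2 P)) :=
    comap_measurable _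
  have hfst : Measurable[hL.productSystem.borelStructure]
      fun p : Σ t : PosTime, levyFiber L P t => p.1 := measurable_fst.comp hm
  have hadd := (((measurable_subtype_coe.comp hfst).comp measurable_fst).add
    ((measurable_subtype_coe.comp hfst).comp measurable_snd)).subtype_mk
    (h := fun p : (Σ t : PosTime, levyFiber L P t) × (Σ t : PosTime, levyFiber L P t) =>
      add_pos p.1.1.2 p.2.1.2)
  refine
    { trivializable := ⟨fun t => (e t).repr, hfst.prodMk (measurable_repr he hm), ?_⟩
      measurable_mul := ?_
      add_mul := hL.add_mulFiber
      mul_add := hL.mulFiber_add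
      smul_mul := hL.smul_mulFiber
      mul_smul := hL.mulFiber_smul
      inner_mul := hL.inner_mulFiber
      dense_mul := fun s t => hL.dense_mulFiber hT s.2
      mul_assoc := fun x y z => hL.total_ext (add_assoc _ _ _).symm (hL.mulFiber_assoc x y z) }
  · exact measurable_comap_iff.2
      (measurable_fst.prodMk (stronglyMeasurable_repr_symm he).measurable)
  · exact measurable_comap_iff.2 (hadd.prodMk (hL.measurable_mulFiber he hee hm))

end IsLevyProcess

end ProductSystems

theorem mainTheorem6 {Ω : Type*} {B : Type*} [MeasurableSpace Ω] [NormedAddCommGroup B]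
    [NormedSpace ℝ B] [CompleteSpace B] [SecondCountableTopology B] [Nontrivial B]
    [MeasurableSpace B] [BorelSpace B]
    (P : MeasureTheory.Measure Ω) [MeasureTheory.IsProbabilityMeasure P]
    (L : ℝ≥0 → Ω → B) (hL : ProductSystems.IsLevyProcess L P)
    (b : B) (Q : LinearMap.BilinForm ℝ (StrongDual ℝ B)) (hQ : Q.Nondegenerate)
    (hT : ProductSystems.HasTriplet L P b Q 0) :
    hL.productSystem.IsProductSystem ∧ hL.productSystem.IsCompletelySpatial :=
  ⟨hL.isProductSystem_productSystem hQ hT, hL.isCompletelySpatial_productSystem hT⟩
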